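/- Let $\mu$ be a Borel probability measure on $\mathbb{R}^n$, let $\nu$ be a $\sigma$-finite Borel measure on $\mathbb{R}^n$ with $\mu\ll\nu$, and let $Q\in\mathbb{R}^{n\times n}$ be symmetric positive semidefinite. On some probability space let $x\sim\mu$, $z\sim N(0,I_n)$ and $\tau\sim\mathrm{Unif}([1,2])$ be (mutually) independent, put $$y=\sqrt{\tau}\,x+Q^{1/2}z,\qquad \theta=(y,\tau),$$ and let $\mu_\theta$ be the (regular) conditional law of $x$ given $\theta$. For a probability measure $\rho\ll\nu$ write $D(\rho\|\nu)=\mathbb{E}_\rho\log\frac{d\rho}{d\nu}$, which is said to be well defined in $(-\infty,+\infty]$ if the negative part of $\log\frac{d\rho}{d\nu}$ is $\rho$-integrable. $\mathrm{Cov}$ is the covariance matrix, $\preceq$ is the positive semidefinite order, and $\mathbb{E}_\theta$ is the expectation over $\theta$. Then: 1. Almost surely $\mu_\theta$ has finite second moments, the entries of $\mathrm{Cov}(\mu_\theta)$ are integrable, and $$\mathbb{E}_\theta\,\mathrm{Cov}(\mu_\theta)\preceq Q .$$ 2. Let $Q$ be invertible. Then $\mu_\theta\ll\mu$ almost surely.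 If moreover $D(\mu\|\nu)$ is well defined in $(-\infty,+\infty]$, then $\mathbb{E}_\theta D(\mu_\theta\|\nu)$ is well defined in $(-\infty,+\infty]$ and $$D(\mu\|\nu)\le \mathbb{E}_\theta D(\mu_\theta\|\nu),$$ and if in addition $\mu$ has finite second moments, then $$\mathbb{E}_\theta D(\mu_\theta\|\nu)\le D(\mu\|\nu)+\tfrac12\log\det\big(I_n+2Q^{-1}\mathrm{Cov}(\mu)\big).$$ In particular, when $D(\mu\|\nu)$ is finite and $\mu$ has finite second moments, $$0\le \mathbb{E}_\theta D(\mu_\theta\|\nu)-D(\mu\|\nu)\le \tfrac12\log\det\big(I_n+2Q^{-1}\mathrm{Cov}(\mu)\big).$$ 3. If $Q$ is invertible and $\mu$ has finite second moments, then the entries of $\mathrm{Cov}(\mu_\theta)Q^{-1}\mathrm{Cov}(\mu_\theta)$ are integrable and $$\mathbb{E}_\theta\big[\mathrm{Cov}(\mu_\theta)\,Q^{-1}\,\mathrm{Cov}(\mu_\theta)\big]\preceq \mathrm{Cov}(\mu).$$ -/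

import Mathlib

open MeasureTheory ProbabilityTheory
open scoped ENNReal MatrixOrder

noncomputable section

namespace GaussChannel

/-- The expectation of an extended-real function, `E f⁺ - E f⁻` with both terms in `[0, ∞]`.
By the conventions of `EReal` the value is `⊥` as soon as `E f⁻ = ∞`; hence a value `≠ ⊥` says
that `f` has a well-defined expectation in `(-∞, ∞]`. -/
def extExpectation {α : Type*} [MeasurableSpace α] (f : α → EReal) (P : Measure α) : EReal :=
  ((∫⁻ a, (f a).toENNReal ∂P : ℝ≥0∞) : EReal) - ((∫⁻ a, (-f a).toENNReal ∂P : ℝ≥0∞) : EReal)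

open Classical in
/-- Relative entropy `D(ρ‖ν) = E_ρ log (dρ/dν)` with respect to a reference measure `ν` which need
not be finite, and `+∞` if `ρ` is not absolutely continuous with respect to `ν`. The reference
measure being arbitrary, negative values are possible. -/
def relEntropy {α : Type*} [MeasurableSpace α] (ρ ν : Measure α) : EReal :=
  if ρ ≪ ν then extExpectation (fun a => ((llr ρ ν a : ℝ) : EReal)) ρ else ⊤

/-- The covariance matrix of a measure on `ℝⁿ` (meaningful for finite second moments). -/
def Cov {n : ℕ} (ρ : Measure (EuclideanSpace ℝ (Fin n))) : Matrix (Fin n) (Fin n) ℝ :=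
  Matrix.of fun i j => covariance (fun v => v i) (fun v => v j) ρ

/-- The entrywise expectation of a random matrix (meaningful if all entries are integrable). -/
def expMatrix {n : ℕ} {Ω : Type*} [MeasurableSpace Ω] (P : Measure Ω)
    (M : Ω → Matrix (Fin n) (Fin n) ℝ) : Matrix (Fin n) (Fin n) ℝ :=
  Matrix.of fun i j => ∫ ω, M ω i j ∂P

/-- The observation `θ = (y, τ)`, where `y = √τ x + Q^{1/2} z`. -/
def observation {n : ℕ} {Ω : Type*} (Q : Matrix (Fin n) (Fin n) ℝ)
    (x z : Ω → EuclideanSpace ℝ (Fin n)) (τ : Ω → ℝ) (ω : Ω) : EuclideanSpace ℝ (Fin n) × ℝ :=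
  (√(τ ω) • x ω + Matrix.toEuclideanCLM (𝕜 := ℝ) (CFC.sqrt Q) (z ω), τ ω)

/-- The random measure `μ_θ`: the regular conditional law of `x` given `θ = (y, τ)`, evaluated at
the observed value of `θ`. -/
def posterior {n : ℕ} {Ω : Type*} [MeasurableSpace Ω] (P : Measure Ω) [IsFiniteMeasure P]
    (Q : Matrix (Fin n) (Fin n) ℝ) (x z : Ω → EuclideanSpace ℝ (Fin n)) (τ : Ω → ℝ) (ω : Ω) :
    Measure (EuclideanSpace ℝ (Fin n)) :=
  condDistrib x (observation Q x z τ) P (observation Q x z τ ω)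

end GaussChannel

end

/-!
The argument rests on an explicit version of the posterior. For invertible `Q` write
`B = Q^{1/2}`. The law of `(θ, x)` has the density
`likelihood B θ x = exp (-‖B⁻¹ y - √τ B⁻¹ x‖² / 2)` with respect to the product of a reference
measure in `θ` and `μ`, so Bayes' formula gives the posterior as `μ` reweighted by
`likelihood / evidence` (`map_channel_eq_compProd`, `posterior_ae_eq_posteriorKernel`).

*First bound.* The estimator `y / √τ` of `x` has error `-Q^{1/2} z / √τ`, whose second moment matrix
is at most `Q` because `τ ≥ 1`. The posterior variance in any direction is at most the conditional
mean square error of any function of `θ`. No moment of `μ` enters, and `Q` may be singular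
(`lintegral_posterior_sq_error_le`).

*Second bound.* The chain rule for densities splits `E D(μ_θ‖ν)` into the mutual information
`E log (likelihood / evidence)` and `D(μ‖ν)` (`extExpectation_relEntropy_posteriorKernel`); both
summands have integrable negative part, so the extended expectations add up. The mutual information
is nonnegative by `log t ≥ 1 - 1 / t` and `E (evidence / likelihood) = 1`. For the upper bound the
evidence is compared with a Gaussian density `h` of covariance `Q + 2 Cov μ`: by `log t ≤ t - 1` and
`E (h / evidence) = 1` the mutual information is at most `E log (likelihood / h)`, an explicit
second moment computation (`extExpectation_infoDensity_le`).

*Third bound.* Let `f s` be the expected posterior variance of `⟪u, x⟫` when the observation is made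
with fixed `τ = s`. An observation at `s + δ` contains the same information about `x` as one
at `s` together with an independent observation `√δ x + Q^{1/2} z'`; this is the rotation invariance of
a pair of Gaussians. Correcting the posterior mean at `s` linearly in the second observation, with
coefficient `√δ Q⁻¹ C u` where `C` is the posterior covariance, yields the discrete dissipation
inequality `f (s + δ) + δ E ⟪u, C Q⁻¹ C u⟫ ≤ f s + O(δ²)` (`mmse_add_le`), after a truncation that
makes the error term uniform. Averaging over `s ∈ [1, 2]` telescopes, and `δ → 0` gives
`∫_1^2 E ⟪u, C Q⁻¹ C u⟫ ds ≤ Var ⟪u, x⟫` without differentiating `f` (`lintegral_le_of_dissipation`,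
`lintegral_cov_inv_cov_le`).
-/

set_option linter.unusedSectionVars false

noncomputable section

namespace GaussChannel

/-! ### Expectations of extended-real functions -/

section

section ExtExpectation

variable {α β : Type*} [MeasurableSpace α] [MeasurableSpace β]

theorem extExpectation_congr {P : Measure α} {f g : α → EReal} (h : f =ᵐ[P] g) :
    extExpectation f P = extExpectation g P := by
  unfold extExpectation
  congr 2
  · exact lintegral_congr_ae (h.mono fun a ha => by simp only [ha])
  · exact lintegral_congr_ae (h.mono fun a ha => by simp only [ha])

theorem extExpectation_mono {P : Measure α} {f g : α → EReal} (h : f ≤ᵐ[P] g) :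
    extExpectation f P ≤ extExpectation g P := by
  unfold extExpectation
  refine EReal.sub_le_sub ?_ ?_
  · exact EReal.coe_ennreal_le_coe_ennreal_iff.2
      (lintegral_mono_ae (h.mono fun a ha => EReal.toENNReal_le_toENNReal ha))
  · exact EReal.coe_ennreal_le_coe_ennreal_iff.2
      (lintegral_mono_ae (h.mono fun a ha => EReal.toENNReal_le_toENNReal (EReal.neg_le_neg_iff.2 ha)))

theorem ereal_sub_eq_sub_of_add_eq_add {a b c d : ℝ≥0∞} (h : a + b = c + d) (hb : b ≠ ⊤)
    (hd : d ≠ ⊤) : (a : EReal) - d = (c : EReal) - b := by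
  by_cases ha : a = ⊤
  · have hc : c = ⊤ := by
      by_contra hc
      exact (ENNReal.add_ne_top.2 ⟨hc, hd⟩) (by rw [← h, ha]; simp)
    subst ha hc
    lift b to NNReal using hb
    lift d to NNReal using hd
    rfl
  · have hc : c ≠ ⊤ := by
      rintro rfl
      exact (ENNReal.add_ne_top.2 ⟨ha, hb⟩) (by rw [h]; simp)
    lift a to NNReal using ha
    lift b to NNReal using hb
    lift c to NNReal using hc
    lift d to NNReal using hd
    have h' : (a : ℝ) + b = c + d := by exact_mod_cast h
    have : (a : ℝ) - d = c - b := by linarith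
    change (((a : ℝ) : EReal)) - ((d : ℝ) : EReal) = ((c : ℝ) : EReal) - ((b : ℝ) : EReal)
    exact_mod_cast this

/-- The extended expectation may be computed from any decomposition into nonnegative parts, not only
from the minimal one, provided the part that is subtracted has finite expectation. -/
theorem extExpectation_sub {P : Measure α} {A B : α → ℝ≥0∞} (hA : AEMeasurable A P)
    (hB : AEMeasurable B P) (hfin : ∫⁻ a, B a ∂P ≠ ⊤) :
    extExpectation (fun a => (A a : EReal) - (B a : EReal)) P
      = ((∫⁻ a, A a ∂P : ℝ≥0∞) : EReal) - ((∫⁻ a, B a ∂P : ℝ≥0∞) : EReal) := by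
  have hBt : ∀ᵐ a ∂P, B a < ⊤ := ae_lt_top' hB hfin
  have e1 : ∀ a, ((A a : EReal) - (B a : EReal)).toENNReal = A a - B a := fun a => by
    rw [EReal.toENNReal_sub (EReal.coe_ennreal_nonneg _)]; simp
  have e2 : ∀ᵐ a ∂P, (-((A a : EReal) - (B a : EReal))).toENNReal = B a - A a := by
    filter_upwards [hBt] with a ha
    rw [EReal.neg_sub (Or.inr (by simp)) (Or.inr (by simp [ha.ne])), add_comm, ← sub_eq_add_neg,
      EReal.toENNReal_sub (EReal.coe_ennreal_nonneg _)]
    simp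
  unfold extExpectation
  rw [lintegral_congr e1, lintegral_congr_ae e2]
  refine ereal_sub_eq_sub_of_add_eq_add ?_ hfin ?_
  · rw [← lintegral_add_right' _ hB, ← lintegral_add_left' hA]
    refine lintegral_congr fun a => ?_
    rw [tsub_add_eq_max, add_comm (A a), tsub_add_eq_max, max_comm]
  · exact ne_top_of_le_ne_top hfin (lintegral_mono fun a => tsub_le_self)

theorem extExpectation_coe (P : Measure α) (f : α → ℝ) :
    extExpectation (fun a => (f a : EReal)) P =
      ((∫⁻ a, ENNReal.ofReal (f a) ∂P : ℝ≥0∞) : EReal)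
        - ((∫⁻ a, ENNReal.ofReal (-f a) ∂P : ℝ≥0∞) : EReal) := by
  unfold extExpectation
  simp only [EReal.real_coe_toENNReal, ← EReal.coe_neg]

theorem extExpectation_coe_eq_integral {P : Measure α} {f : α → ℝ} (hf : Integrable f P) :
    extExpectation (fun a => (f a : EReal)) P = ((∫ a, f a ∂P : ℝ) : EReal) := by
  have h1 : ∫⁻ a, ENNReal.ofReal (f a) ∂P ≠ ⊤ := hf.lintegral_lt_top.ne
  have h2 : ∫⁻ a, ENNReal.ofReal (-f a) ∂P ≠ ⊤ := hf.neg.lintegral_lt_top.ne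
  rw [extExpectation_coe, integral_eq_lintegral_pos_part_sub_lintegral_neg_part hf, EReal.coe_sub,
    EReal.coe_ennreal_toReal h1, EReal.coe_ennreal_toReal h2]

theorem lintegral_neg_ne_top_of_extExpectation_ne_bot {P : Measure α} {f : α → ℝ}
    (h : extExpectation (fun a => (f a : EReal)) P ≠ ⊥) :
    ∫⁻ a, ENNReal.ofReal (-f a) ∂P ≠ ⊤ := by
  intro h'
  rw [extExpectation_coe, h'] at h
  exact h (by simp)

theorem ereal_add_sub_add_comm {a b c d : ℝ≥0∞} (hb : b ≠ ⊤) (hd : d ≠ ⊤) :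
    (((a + c : ℝ≥0∞) : EReal)) - ((b + d : ℝ≥0∞) : EReal) =
      ((a : EReal) - b) + ((c : EReal) - d) := by
  lift b to NNReal using hb
  lift d to NNReal using hd
  by_cases ha : a = ⊤
  · subst ha
    by_cases hc : c = ⊤
    · subst hc; rfl
    · lift c to NNReal using hc; rfl
  · lift a to NNReal using ha
    by_cases hc : c = ⊤
    · subst hc; rfl
    · lift c to NNReal using hc
      change (((a + c : ℝ) : EReal)) - ((b + d : ℝ) : EReal) =
        (((a : ℝ) : EReal) - ((b : ℝ) : EReal)) + (((c : ℝ) : EReal) - ((d : ℝ) : EReal))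
      have : (a + c : ℝ) - (b + d) = (a - b) + (c - d) := by ring
      exact_mod_cast this

theorem coe_eq_ofReal_sub_ofReal_neg (x : ℝ) :
    (x : EReal) = (ENNReal.ofReal x : EReal) - (ENNReal.ofReal (-x) : EReal) := by
  rcases le_total 0 x with h | h
  · rw [ENNReal.ofReal_of_nonpos (neg_nonpos.2 h)]; simp [h]
  · rw [ENNReal.ofReal_of_nonpos h]; simp [h]

theorem extExpectation_add {P : Measure α} {f g : α → ℝ} (hf : AEMeasurable f P)
    (hg : AEMeasurable g P) (hf' : ∫⁻ a, ENNReal.ofReal (-f a) ∂P ≠ ⊤)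
    (hg' : ∫⁻ a, ENNReal.ofReal (-g a) ∂P ≠ ⊤) :
    extExpectation (fun a => ((f a + g a : ℝ) : EReal)) P =
      extExpectation (fun a => (f a : EReal)) P + extExpectation (fun a => (g a : EReal)) P := by
  have hfn : AEMeasurable (fun a => -f a) P := hf.neg
  have hsum : ∫⁻ a, (ENNReal.ofReal (-f a) + ENNReal.ofReal (-g a)) ∂P ≠ ⊤ := by
    rw [lintegral_add_left' hfn.ennreal_ofReal]; exact ENNReal.add_ne_top.2 ⟨hf', hg'⟩
  have := extExpectation_sub (P := P)
    (A := fun a => ENNReal.ofReal (f a) + ENNReal.ofReal (g a))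
    (B := fun a => ENNReal.ofReal (-f a) + ENNReal.ofReal (-g a))
    (hf.ennreal_ofReal.add hg.ennreal_ofReal) (hf.neg.ennreal_ofReal.add hg.neg.ennreal_ofReal) hsum
  rw [lintegral_add_left' hf.ennreal_ofReal, lintegral_add_left' hfn.ennreal_ofReal,
    ereal_add_sub_add_comm hf' hg'] at this
  rw [extExpectation_coe P f, extExpectation_coe P g, ← this]
  congr 1
  funext a
  rw [ereal_add_sub_add_comm ENNReal.ofReal_ne_top ENNReal.ofReal_ne_top,
    ← coe_eq_ofReal_sub_ofReal_neg, ← coe_eq_ofReal_sub_ofReal_neg, EReal.coe_add]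

/-- Law of total expectation for extended-real expectations. -/
theorem extExpectation_compProd {ρ : Measure α} [SFinite ρ] {κ : Kernel α β} [IsSFiniteKernel κ]
    {f : α × β → ℝ} (hf : Measurable f)
    (hf' : ∫⁻ p, ENNReal.ofReal (-f p) ∂(ρ ⊗ₘ κ) ≠ ⊤) :
    extExpectation (fun a => extExpectation (fun b => (f (a, b) : EReal)) (κ a)) ρ =
      extExpectation (fun p => (f p : EReal)) (ρ ⊗ₘ κ) := by
  have hfn : Measurable (fun p => -f p) := hf.neg
  rw [Measure.lintegral_compProd hfn.ennreal_ofReal] at hf'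
  rw [extExpectation_coe, Measure.lintegral_compProd hf.ennreal_ofReal,
    Measure.lintegral_compProd hfn.ennreal_ofReal, ← extExpectation_sub _ _ hf']
  · congr 1
  · exact (Measurable.lintegral_kernel_prod_right' hf.ennreal_ofReal).aemeasurable
  · exact (Measurable.lintegral_kernel_prod_right' hf.neg.ennreal_ofReal).aemeasurable

theorem measurable_extExpectation_kernel {κ : Kernel α β} [IsSFiniteKernel κ]
    {f : α × β → ℝ} (hf : Measurable f) :
    Measurable (fun a => extExpectation (fun b => (f (a, b) : EReal)) (κ a)) := by
  simp only [extExpectation_coe, sub_eq_add_neg]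
  exact (Measurable.lintegral_kernel_prod_right' hf.ennreal_ofReal).coe_ereal_ennreal.add
    (Measurable.lintegral_kernel_prod_right' hf.neg.ennreal_ofReal).coe_ereal_ennreal.neg

theorem extExpectation_map {P : Measure α} {φ : α → β} (hφ : AEMeasurable φ P) {f : β → EReal}
    (hf : AEMeasurable f (P.map φ)) :
    extExpectation f (P.map φ) = extExpectation (fun a => f (φ a)) P := by
  unfold extExpectation
  have hfn : AEMeasurable (fun b => -f b) (P.map φ) := hf.neg
  rw [lintegral_map' hf.ereal_toENNReal hφ, lintegral_map' hfn.ereal_toENNReal hφ]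

end ExtExpectation

end

/-! ### The Gaussian channel and its posterior kernel -/

section

section Bayes

variable {α β : Type*} [MeasurableSpace α] [MeasurableSpace β]

/-- Bayes' formula: a density on a product factors as its marginal times the normalised
conditional densities. -/
theorem withDensity_prod_eq_compProd (l : Measure α) [SFinite l] (μ : Measure β)
    [IsProbabilityMeasure μ] {G : α → β → ℝ≥0∞} (hG : Measurable (Function.uncurry G))
    (h0 : ∀ a, ∫⁻ b, G a b ∂μ ≠ 0) (h1 : ∀ a, ∫⁻ b, G a b ∂μ ≠ ⊤) {κ : Kernel α β}
    [IsSFiniteKernel κ] (hκ : ∀ a, κ a = μ.withDensity (fun b => G a b / ∫⁻ b, G a b ∂μ)) :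
    (l.prod μ).withDensity (Function.uncurry G) =
      (l.withDensity fun a => ∫⁻ b, G a b ∂μ) ⊗ₘ κ := by
  have hZ : Measurable fun a => ∫⁻ b, G a b ∂μ := hG.lintegral_prod_right'
  refine Measure.ext_of_lintegral _ fun f hf => ?_
  have hGa : ∀ a, Measurable (G a) := fun a => hG.comp measurable_prodMk_left
  rw [lintegral_withDensity_eq_lintegral_mul _ hG hf, Measure.lintegral_compProd hf,
    lintegral_prod _ (hG.mul hf).aemeasurable,
    lintegral_withDensity_eq_lintegral_mul _ hZ
      (Measurable.lintegral_kernel_prod_right' hf)]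
  refine lintegral_congr fun a => ?_
  have hfa : Measurable fun b => f (a, b) := hf.comp measurable_prodMk_left
  simp only [Pi.mul_apply, Function.uncurry_apply_pair]
  rw [hκ a, lintegral_withDensity_eq_lintegral_mul _ ((hGa a).div_const _) hfa,
    ← lintegral_const_mul _ (((hGa a).div_const _).mul hfa)]
  refine lintegral_congr fun b => ?_
  simp only [Pi.mul_apply]
  rw [← mul_assoc, ENNReal.mul_div_cancel (h0 a) (h1 a)]

end Bayes

variable {E : Type*} [NormedAddCommGroup E] [InnerProductSpace ℝ E] [FiniteDimensional ℝ E]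
  [MeasurableSpace E] [BorelSpace E]

theorem integrable_exp_neg_norm_sq_div_two :
    Integrable (fun v : E => Real.exp (-‖v‖ ^ 2 / 2)) volume := by
  refine Integrable.of_integral_ne_zero ?_
  have := GaussianFourier.integral_rexp_neg_mul_sq_norm (V := E) (b := 1 / 2) (by norm_num)
  have e : (fun v : E => Real.exp (-‖v‖ ^ 2 / 2)) = fun v => Real.exp (-(1 / 2) * ‖v‖ ^ 2) := by
    funext v; congr 1; ring
  rw [e, this]
  positivity

variable (E) in
/-- The normalising constant of the standard Gaussian density on `E`. -/
def gaussConst : ℝ≥0∞ := (∫⁻ v : E, ENNReal.ofReal (Real.exp (-‖v‖ ^ 2 / 2)))⁻¹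

/-- The Lebesgue density of the standard Gaussian measure, identified by the characteristic
function. -/
theorem stdGaussian_eq_withDensity :
    stdGaussian E = gaussConst E •
      (volume : Measure E).withDensity fun v => ENNReal.ofReal (Real.exp (-‖v‖ ^ 2 / 2)) := by
  set g : E → ℝ := fun v => Real.exp (-‖v‖ ^ 2 / 2) with hg
  have hgi : Integrable g volume := integrable_exp_neg_norm_sq_div_two
  have hg0 : ∀ v, 0 ≤ g v := fun v => (Real.exp_pos _).le
  have hF : ∀ t : E, ∫ v : E, (g v : ℂ) * Complex.exp (inner ℝ v t * Complex.I) =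
      ((∫ v : E, g v : ℝ) : ℂ) * Complex.exp (-‖t‖ ^ 2 / 2) := by
    have key := fun t : E => GaussianFourier.integral_cexp_neg_mul_sq_norm_add (V := E)
      (b := 1 / 2) (by norm_num) Complex.I t
    have h1 : ∀ t : E, ∫ v : E, (g v : ℂ) * Complex.exp (inner ℝ v t * Complex.I) =
        (Real.pi / (1 / 2)) ^ (Module.finrank ℝ E / 2 : ℂ) * Complex.exp (-‖t‖ ^ 2 / 2) := by
      intro t
      convert key t using 2
      · funext v
        rw [hg, Complex.ofReal_exp, ← Complex.exp_add, real_inner_comm]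
        congr 1
        push_cast
        ring
      · rw [Complex.I_sq]; congr 1; ring
    intro t
    rw [h1 t]
    congr 1
    have h0 := h1 0
    simp only [inner_zero_right, Complex.ofReal_zero, zero_mul, Complex.exp_zero, mul_one, norm_zero,
      ne_eq, OfNat.ofNat_ne_zero, not_false_eq_true, zero_pow, neg_zero, zero_div] at h0
    rw [← h0, integral_complex_ofReal]
  have hK : 0 < ∫ v : E, g v := by
    refine (integral_pos_iff_support_of_nonneg hg0 hgi).2 ?_
    have : Function.support g = Set.univ := Set.eq_univ_of_forall fun v => (Real.exp_pos _).ne'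
    rw [this]
    exact (Measure.measure_univ_pos).2 (NeZero.ne _)
  have hc : gaussConst E = (ENNReal.ofReal (∫ v : E, g v))⁻¹ := by
    rw [gaussConst, ofReal_integral_eq_lintegral_ofReal hgi (ae_of_all _ hg0)]
  have hfin : IsFiniteMeasure ((volume : Measure E).withDensity fun v => ENNReal.ofReal (g v)) :=
    isFiniteMeasure_withDensity_ofReal hgi.2
  have : IsFiniteMeasure (gaussConst E •
      (volume : Measure E).withDensity fun v => ENNReal.ofReal (g v)) :=
    Measure.smul_finite _ (by rw [hc]; simpa using hK)
  refine Measure.ext_of_charFun ?_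
  funext t
  rw [charFun_stdGaussian, charFun_apply, integral_smul_measure,
    integral_withDensity_eq_integral_toReal_smul (by fun_prop) (ae_of_all _ fun _ => by simp)]
  have : ∀ v, (ENNReal.ofReal (g v)).toReal • Complex.exp (inner ℝ v t * Complex.I) =
      (g v : ℂ) * Complex.exp (inner ℝ v t * Complex.I) := fun v => by
    rw [ENNReal.toReal_ofReal (hg0 v)]; simp
  change _ = _ • ∫ v, (ENNReal.ofReal (g v)).toReal • Complex.exp (inner ℝ v t * Complex.I)
  simp only [this, hF t, hc, ENNReal.toReal_inv, ENNReal.toReal_ofReal hK.le]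
  rw [Complex.real_smul, ← mul_assoc, Complex.ofReal_inv, inv_mul_cancel₀, one_mul]
  exact_mod_cast hK.ne'

/-- The observation `(√τ x + B z, τ)` as a function of `((x, z), τ)`. -/
def channelMap (B : E ≃L[ℝ] E) (p : (E × E) × ℝ) : E × ℝ := (√p.2 • p.1.1 + B p.1.2, p.2)

/-- The likelihood of the signal `x` given the observation `θ = (y, τ)`, without its normalising
constant. -/
def likelihood (B : E ≃L[ℝ] E) (θ : E × ℝ) (x : E) : ℝ :=
  Real.exp (-‖B.symm θ.1 - √θ.2 • B.symm x‖ ^ 2 / 2)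

/-- The mean of the likelihood under the prior, i.e. the density of the observation with respect to
`refMeasure`. -/
def evidence (B : E ≃L[ℝ] E) (μ : Measure E) (θ : E × ℝ) : ℝ≥0∞ :=
  ∫⁻ x, ENNReal.ofReal (likelihood B θ x) ∂μ

/-- The posterior law of the signal given by Bayes' formula, defined for every observation. -/
def posteriorKernel (B : E ≃L[ℝ] E) (μ : Measure E) [SFinite μ] : Kernel (E × ℝ) E :=
  (Kernel.const (E × ℝ) μ).withDensity
    fun θ x => ENNReal.ofReal (likelihood B θ x) / evidence B μ θ

/-- The reference measure on the space of observations. The first factor is a multiple of the image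
of Lebesgue measure under `B`, normalised so that `likelihood` needs no further constant and no
determinant of `B` appears. -/
def refMeasure (B : E ≃L[ℝ] E) (U : Measure ℝ) : Measure (E × ℝ) :=
  (gaussConst E • (volume : Measure E).map B).prod U

variable (B : E ≃L[ℝ] E) (μ : Measure E)

theorem measurable_channelMap : Measurable (channelMap B) := by
  unfold channelMap; fun_prop

theorem continuous_likelihood : Continuous (Function.uncurry (likelihood B)) := by
  unfold likelihood Function.uncurry; fun_prop

theorem measurable_likelihood : Measurable (Function.uncurry (likelihood B)) :=
  (continuous_likelihood B).measurable

theorem measurable_likelihood_right (θ : E × ℝ) : Measurable (likelihood B θ) :=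
  (measurable_likelihood B).of_uncurry_left

theorem likelihood_pos (θ : E × ℝ) (x : E) : 0 < likelihood B θ x := Real.exp_pos _

theorem likelihood_le_one (θ : E × ℝ) (x : E) : likelihood B θ x ≤ 1 :=
  Real.exp_le_one_iff.2 (by have := sq_nonneg ‖B.symm θ.1 - √θ.2 • B.symm x‖; linarith)

theorem measurable_evidence [SFinite μ] : Measurable (evidence B μ) :=
  Measurable.lintegral_prod_right' (measurable_likelihood B).ennreal_ofReal

theorem evidence_le_one [IsProbabilityMeasure μ] (θ : E × ℝ) : evidence B μ θ ≤ 1 := by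
  calc evidence B μ θ ≤ ∫⁻ _, 1 ∂μ :=
        lintegral_mono fun x => ENNReal.ofReal_le_one.2 (likelihood_le_one B θ x)
    _ = 1 := by simp

theorem evidence_ne_top [IsProbabilityMeasure μ] (θ : E × ℝ) : evidence B μ θ ≠ ⊤ :=
  ne_top_of_le_ne_top ENNReal.one_ne_top (evidence_le_one B μ θ)

theorem evidence_ne_zero [IsProbabilityMeasure μ] (θ : E × ℝ) : evidence B μ θ ≠ 0 := by
  unfold evidence
  rw [Ne, lintegral_eq_zero_iff (measurable_likelihood_right B θ).ennreal_ofReal]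
  intro h
  have : ∀ᵐ x ∂μ, False := h.mono fun x hx => by
    have := likelihood_pos B θ x
    simp only [Pi.zero_apply, ENNReal.ofReal_eq_zero] at hx
    linarith
  exact IsProbabilityMeasure.ne_zero μ (by simpa using this)

theorem measurable_density [SFinite μ] : Measurable (Function.uncurry fun (θ : E × ℝ) x =>
    ENNReal.ofReal (likelihood B θ x) / evidence B μ θ) :=
  (measurable_likelihood B).ennreal_ofReal.div ((measurable_evidence B μ).comp measurable_fst)

theorem posteriorKernel_apply [SFinite μ] (θ : E × ℝ) : posteriorKernel B μ θ =
    μ.withDensity fun x => ENNReal.ofReal (likelihood B θ x) / evidence B μ θ := by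
  rw [posteriorKernel, Kernel.withDensity_apply _ (measurable_density B μ), Kernel.const_apply]

instance [IsProbabilityMeasure μ] : IsMarkovKernel (posteriorKernel B μ) where
  isProbabilityMeasure θ := by
    constructor
    rw [posteriorKernel_apply, withDensity_apply _ MeasurableSet.univ, Measure.restrict_univ]
    simp only [div_eq_mul_inv]
    rw [lintegral_mul_const _ (measurable_likelihood_right B θ).ennreal_ofReal]
    exact ENNReal.mul_inv_cancel (evidence_ne_zero B μ θ) (evidence_ne_top B μ θ)

theorem posteriorKernel_absolutelyContinuous [SFinite μ] (θ : E × ℝ) :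
    posteriorKernel B μ θ ≪ μ := by
  rw [posteriorKernel_apply]; exact withDensity_absolutelyContinuous _ _

/-- The law of `r + B z` in terms of the reference measure: a translation of Lebesgue measure. -/
theorem lintegral_channel_noise (r : E) {f : E → ℝ≥0∞} (hf : Measurable f) :
    ∫⁻ z, f (r + B z) ∂(stdGaussian E) = ∫⁻ y, ENNReal.ofReal
      (Real.exp (-‖B.symm y - B.symm r‖ ^ 2 / 2)) * f y ∂(gaussConst E • (volume : Measure E).map B) := by
  have hm : Measurable fun z => f (r + B z) := by fun_prop
  rw [stdGaussian_eq_withDensity, lintegral_smul_measure, lintegral_smul_measure,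
    lintegral_withDensity_eq_lintegral_mul _ (by fun_prop) hm, lintegral_map (by fun_prop) (by fun_prop),
    ← lintegral_add_right_eq_self (fun z : E => _ * f (B z)) (B.symm r)]
  congr 1
  refine lintegral_congr fun z => ?_
  simp [add_comm]

/-- The joint law of observation and signal has density `likelihood`. -/
theorem map_channel_eq_withDensity [IsProbabilityMeasure μ] (U : Measure ℝ) [IsProbabilityMeasure U] :
    Measure.map (fun p => (channelMap B p, p.1.1)) ((μ.prod (stdGaussian E)).prod U) =
      ((refMeasure B U).prod μ).withDensity
        (Function.uncurry fun θ x => ENNReal.ofReal (likelihood B θ x)) := by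
  have hΦ : Measurable fun p : (E × E) × ℝ => (channelMap B p, p.1.1) :=
    (measurable_channelMap B).prodMk (by fun_prop)
  have hG : Measurable (Function.uncurry fun (θ : E × ℝ) x => ENNReal.ofReal (likelihood B θ x)) :=
    (measurable_likelihood B).ennreal_ofReal
  refine Measure.ext_of_lintegral _ fun f hf => ?_
  have hgf := hG.mul hf
  have hFm : Measurable fun p : (E × E) × ℝ => f (channelMap B p, p.1.1) := hf.comp hΦ
  rw [lintegral_map hf hΦ, lintegral_withDensity_eq_lintegral_mul _ hG hf,
    lintegral_prod_symm' _ hFm, lintegral_prod _ hgf.aemeasurable, refMeasure,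
    lintegral_prod_symm' _ hgf.lintegral_prod_right']
  refine lintegral_congr fun t => ?_
  have hFt : Measurable fun p : E × E => f (channelMap B (p, t), p.1) :=
    hFm.comp measurable_prodMk_right
  have hsw : Measurable fun p : E × E => ((Function.uncurry fun (θ : E × ℝ) x =>
      ENNReal.ofReal (likelihood B θ x)) * f) ((p.1, t), p.2) :=
    hgf.comp (by fun_prop)
  rw [lintegral_prod _ hFt.aemeasurable]
  conv_rhs => rw [lintegral_lintegral_swap hsw.aemeasurable]
  · refine lintegral_congr fun x => ?_
    have hft : Measurable fun y => f ((y, t), x) := by fun_prop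
    simpa [channelMap, likelihood] using lintegral_channel_noise B (√t • x) hft

theorem gaussConst_mul_lintegral : gaussConst E *
    ∫⁻ v : E, ENNReal.ofReal (Real.exp (-‖v‖ ^ 2 / 2)) = 1 := by
  have h := congrArg (fun m : Measure E => m Set.univ) (stdGaussian_eq_withDensity (E := E))
  simpa using h.symm

/-- The law of the observation for a signal of law `μ` and a time of law `U`. -/
def obsLaw (U : Measure ℝ) : Measure (E × ℝ) :=
  Measure.map (channelMap B) ((μ.prod (stdGaussian E)).prod U)

instance (U : Measure ℝ) [IsProbabilityMeasure U] [IsProbabilityMeasure μ] :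
    IsProbabilityMeasure (obsLaw B μ U) :=
  Measure.isProbabilityMeasure_map (measurable_channelMap B).aemeasurable

theorem map_channel_eq_withDensity_compProd [IsProbabilityMeasure μ] (U : Measure ℝ) [IsProbabilityMeasure U] :
    Measure.map (fun p => (channelMap B p, p.1.1)) ((μ.prod (stdGaussian E)).prod U) =
      ((refMeasure B U).withDensity (evidence B μ)) ⊗ₘ posteriorKernel B μ := by
  have : SFinite (refMeasure B U) := by unfold refMeasure; infer_instance
  rw [map_channel_eq_withDensity, withDensity_prod_eq_compProd (refMeasure B U) μ
    (κ := posteriorKernel B μ)]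
  · rfl
  · exact (measurable_likelihood B).ennreal_ofReal
  · exact evidence_ne_zero B μ
  · exact evidence_ne_top B μ
  · exact posteriorKernel_apply B μ

theorem obsLaw_eq_withDensity [IsProbabilityMeasure μ] (U : Measure ℝ) [IsProbabilityMeasure U] :
    obsLaw B μ U = (refMeasure B U).withDensity (evidence B μ) := by
  have : SFinite (refMeasure B U) := by unfold refMeasure; infer_instance
  have h := congrArg Measure.fst (map_channel_eq_withDensity_compProd B μ U)
  rw [Measure.fst_compProd, Measure.fst_map_prodMk (by fun_prop)] at h
  exact h

/-- `posteriorKernel` is the conditional law of the signal given the observation. -/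
theorem map_channel_eq_compProd [IsProbabilityMeasure μ] (U : Measure ℝ) [IsProbabilityMeasure U] :
    Measure.map (fun p => (channelMap B p, p.1.1)) ((μ.prod (stdGaussian E)).prod U) =
      obsLaw B μ U ⊗ₘ posteriorKernel B μ := by
  rw [map_channel_eq_withDensity_compProd, obsLaw_eq_withDensity]

theorem lintegral_obsLaw_posteriorKernel [IsProbabilityMeasure μ] (U : Measure ℝ)
    [IsProbabilityMeasure U] {f : (E × ℝ) × E → ℝ≥0∞} (hf : Measurable f) :
    ∫⁻ θ, ∫⁻ x, f (θ, x) ∂(posteriorKernel B μ θ) ∂(obsLaw B μ U) =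
      ∫⁻ t, ∫⁻ x, ∫⁻ z, f ((√t • x + B z, t), x) ∂(stdGaussian E) ∂μ ∂U := by
  have hΦ : Measurable fun p : (E × E) × ℝ => (channelMap B p, p.1.1) :=
    (measurable_channelMap B).prodMk (by fun_prop)
  have hFm : Measurable fun p : (E × E) × ℝ => f (channelMap B p, p.1.1) := hf.comp hΦ
  rw [← Measure.lintegral_compProd hf, ← map_channel_eq_compProd, lintegral_map hf hΦ,
    lintegral_prod_symm' _ hFm]
  refine lintegral_congr fun t => ?_
  have hFt : Measurable fun p : E × E => f (channelMap B (p, t), p.1) :=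
    hFm.comp measurable_prodMk_right
  rw [lintegral_prod _ hFt.aemeasurable]
  rfl

end

/-! ### Entropy of the posterior: chain rule and lower bound -/

section

variable {E : Type*} [NormedAddCommGroup E] [InnerProductSpace ℝ E] [FiniteDimensional ℝ E]
  [MeasurableSpace E] [BorelSpace E]

/-- The cross term vanishes because the Gaussian noise is centred. -/
theorem lintegral_norm_sq_add_clm {F : Type*} [NormedAddCommGroup F] [InnerProductSpace ℝ F]
    (v : F) (A : E →L[ℝ] F) :
    ∫⁻ z, ENNReal.ofReal (‖v + A z‖ ^ 2) ∂(stdGaussian E) =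
      ENNReal.ofReal (‖v‖ ^ 2) + ∫⁻ z, ENNReal.ofReal (‖A z‖ ^ 2) ∂(stdGaussian E) := by
  have hA : MemLp (fun z => A z) 2 (stdGaussian E) :=
    A.comp_memLp' (IsGaussian.memLp_two_id (μ := stdGaussian E))
  have h2 : Integrable (fun z => ‖A z‖ ^ 2) (stdGaussian E) := hA.integrable_norm_pow (by norm_num)
  have h1 : Integrable (fun z => inner ℝ v (A z)) (stdGaussian E) :=
    (hA.integrable (by norm_num)).const_inner v
  have h0 : ∫ z, inner ℝ v (A z) ∂(stdGaussian E) = 0 :=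
    integral_strongDual_stdGaussian ((innerSL ℝ v).comp A)
  have e : ∀ z, ‖v + A z‖ ^ 2 = ‖v‖ ^ 2 + 2 * inner ℝ v (A z) + ‖A z‖ ^ 2 := fun z =>
    norm_add_sq_real _ _
  have hi : Integrable (fun z => ‖v‖ ^ 2 + 2 * inner ℝ v (A z)) (stdGaussian E) :=
    (integrable_const _).add (h1.const_mul 2)
  rw [← ofReal_integral_eq_lintegral_ofReal h2 (ae_of_all _ fun _ => by positivity),
    ← ofReal_integral_eq_lintegral_ofReal _ (ae_of_all _ fun _ => by positivity),
    ← ENNReal.ofReal_add (by positivity) (integral_nonneg fun _ => by positivity)]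
  · congr 1
    simp only [e]
    rw [integral_add hi h2, integral_add (integrable_const _) (h1.const_mul 2),
      integral_const_mul, h0]
    simp
  · simp only [e]; exact hi.add h2

theorem lintegral_norm_sq_stdGaussian_ne_top {F : Type*} [NormedAddCommGroup F] [InnerProductSpace ℝ F]
    (A : E →L[ℝ] F) : ∫⁻ z, ENNReal.ofReal (‖A z‖ ^ 2) ∂(stdGaussian E) ≠ ⊤ := by
  have hA : MemLp (fun z => A z) 2 (stdGaussian E) :=
    A.comp_memLp' (IsGaussian.memLp_two_id (μ := stdGaussian E))
  exact (hA.integrable_norm_pow (by norm_num)).lintegral_lt_top.ne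

variable (B : E ≃L[ℝ] E) (μ : Measure E)

/-- The log-density of the posterior with respect to the prior; its expectation under the joint law
is the mutual information of observation and signal. -/
def infoDensity (q : (E × ℝ) × E) : ℝ :=
  Real.log (likelihood B q.1 q.2) - Real.log (evidence B μ q.1).toReal

/-- The density of the prior with respect to the posterior. -/
def invDensity (q : (E × ℝ) × E) : ℝ := (evidence B μ q.1).toReal / likelihood B q.1 q.2

theorem measurable_invDensity [SFinite μ] : Measurable (invDensity B μ) := by
  have h1 : Measurable fun q : (E × ℝ) × E => likelihood B q.1 q.2 := measurable_likelihood B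
  have h2 : Measurable fun q : (E × ℝ) × E => (evidence B μ q.1).toReal :=
    (measurable_evidence B μ).ennreal_toReal.comp measurable_fst
  exact h2.div h1

theorem invDensity_nonneg (q : (E × ℝ) × E) : 0 ≤ invDensity B μ q :=
  div_nonneg ENNReal.toReal_nonneg (likelihood_pos B q.1 q.2).le

theorem measurable_infoDensity [SFinite μ] : Measurable (infoDensity B μ) := by
  have h1 : Measurable fun q : (E × ℝ) × E => likelihood B q.1 q.2 := measurable_likelihood B
  have h2 : Measurable fun q : (E × ℝ) × E => (evidence B μ q.1).toReal :=
    (measurable_evidence B μ).ennreal_toReal.comp measurable_fst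
  exact h1.log.sub h2.log

theorem llr_posteriorKernel [IsProbabilityMeasure μ] (ν : Measure E) [SigmaFinite ν] (hμν : μ ≪ ν)
    (θ : E × ℝ) :
    ∀ᵐ x ∂(posteriorKernel B μ θ), llr (posteriorKernel B μ θ) ν x =
      infoDensity B μ (θ, x) + llr μ ν x := by
  have hac := posteriorKernel_absolutelyContinuous B μ θ
  have h1 : (posteriorKernel B μ θ).rnDeriv μ =ᵐ[μ] fun x =>
      ENNReal.ofReal (likelihood B θ x) / evidence B μ θ := by
    rw [posteriorKernel_apply]
    exact Measure.rnDeriv_withDensity _ ((measurable_likelihood_right B θ).ennreal_ofReal.div_const _)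
  have h2 := (hac.trans hμν).ae_le (Measure.rnDeriv_mul_rnDeriv (κ := ν) hac)
  have h3 := hac.ae_le (Measure.rnDeriv_pos hμν)
  have h4 := (hac.trans hμν).ae_le (Measure.rnDeriv_lt_top μ ν)
  filter_upwards [hac.ae_le h1, h2, h3, h4] with x h1 h2 h3 h4
  have hZ : 0 < (evidence B μ θ).toReal :=
    ENNReal.toReal_pos (evidence_ne_zero B μ θ) (evidence_ne_top B μ θ)
  have hG := likelihood_pos B θ x
  rw [llr, ← h2, Pi.mul_apply, h1, ENNReal.toReal_mul, ENNReal.toReal_div,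
    ENNReal.toReal_ofReal hG.le, Real.log_mul (div_pos hG hZ).ne' (ENNReal.toReal_pos h3.ne' h4.ne).ne',
    Real.log_div hG.ne' hZ.ne', infoDensity, llr]

theorem relEntropy_posteriorKernel [IsProbabilityMeasure μ] (ν : Measure E) [SigmaFinite ν]
    (hμν : μ ≪ ν) (θ : E × ℝ) : relEntropy (posteriorKernel B μ θ) ν =
      extExpectation (fun x => ((infoDensity B μ (θ, x) + llr μ ν x : ℝ) : EReal))
        (posteriorKernel B μ θ) := by
  rw [relEntropy, if_pos ((posteriorKernel_absolutelyContinuous B μ θ).trans hμν)]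
  refine extExpectation_congr ?_
  filter_upwards [llr_posteriorKernel B μ ν hμν θ] with x hx
  rw [hx]

theorem measurable_relEntropy_posteriorKernel [IsProbabilityMeasure μ] (ν : Measure E) [SigmaFinite ν]
    (hμν : μ ≪ ν) : Measurable fun θ => relEntropy (posteriorKernel B μ θ) ν := by
  simp only [relEntropy_posteriorKernel B μ ν hμν]
  exact measurable_extExpectation_kernel
    ((measurable_infoDensity B μ).add ((measurable_llr μ ν).comp measurable_snd))

section Joint

variable [IsProbabilityMeasure μ] (U : Measure ℝ) [IsProbabilityMeasure U]

theorem lintegral_joint_snd {f : E → ℝ≥0∞} (hf : Measurable f) :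
    ∫⁻ q, f q.2 ∂(obsLaw B μ U ⊗ₘ posteriorKernel B μ) = ∫⁻ x, f x ∂μ := by
  rw [Measure.lintegral_compProd (by fun_prop)]
  rw [lintegral_obsLaw_posteriorKernel B μ U (f := fun q => f q.2) (by fun_prop)]
  simp

/-- The evidence and the likelihood cancel against the posterior density, leaving the mass of `μ`. -/
theorem lintegral_invDensity :
    ∫⁻ q, ENNReal.ofReal (invDensity B μ q) ∂(obsLaw B μ U ⊗ₘ posteriorKernel B μ) = 1 := by
  have hm := measurable_invDensity B μ
  rw [Measure.lintegral_compProd hm.ennreal_ofReal]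
  have : ∀ θ, ∫⁻ x, ENNReal.ofReal (invDensity B μ (θ, x)) ∂(posteriorKernel B μ θ) = 1 := fun θ => by
    have hl := measurable_likelihood_right B θ
    have hmθ : Measurable fun x => ENNReal.ofReal (invDensity B μ (θ, x)) :=
      (hm.comp measurable_prodMk_left).ennreal_ofReal
    rw [posteriorKernel_apply, lintegral_withDensity_eq_lintegral_mul _
      (hl.ennreal_ofReal.div_const _) hmθ]
    have : ∀ x, ((fun x => ENNReal.ofReal (likelihood B θ x) / evidence B μ θ) * fun x =>
        ENNReal.ofReal (invDensity B μ (θ, x))) x = 1 := fun x => by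
      have hG := likelihood_pos B θ x
      have hZ : 0 < (evidence B μ θ).toReal :=
        ENNReal.toReal_pos (evidence_ne_zero B μ θ) (evidence_ne_top B μ θ)
      simp only [Pi.mul_apply]
      rw [← ENNReal.ofReal_toReal (evidence_ne_top B μ θ), ← ENNReal.ofReal_div_of_pos hZ,
        ← ENNReal.ofReal_mul (div_pos hG hZ).le, invDensity,
        div_mul_div_cancel₀ hZ.ne', div_self hG.ne', ENNReal.ofReal_one]
    simp only [this]
    simp
  simp only [this]
  simp

theorem one_sub_invDensity_le_infoDensity (q : (E × ℝ) × E) :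
    1 - invDensity B μ q ≤ infoDensity B μ q := by
  have hG := likelihood_pos B q.1 q.2
  have hZ : 0 < (evidence B μ q.1).toReal :=
    ENNReal.toReal_pos (evidence_ne_zero B μ q.1) (evidence_ne_top B μ q.1)
  have := Real.log_le_sub_one_of_pos (div_pos hZ hG)
  rw [Real.log_div hZ.ne' hG.ne'] at this
  unfold infoDensity invDensity
  linarith

theorem integrable_invDensity :
    Integrable (invDensity B μ) (obsLaw B μ U ⊗ₘ posteriorKernel B μ) := by
  refine ⟨(measurable_invDensity B μ).aestronglyMeasurable, ?_⟩
  rw [hasFiniteIntegral_iff_ofReal (ae_of_all _ (invDensity_nonneg B μ)), lintegral_invDensity]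
  exact ENNReal.one_lt_top

theorem lintegral_neg_infoDensity_ne_top :
    ∫⁻ q, ENNReal.ofReal (-infoDensity B μ q) ∂(obsLaw B μ U ⊗ₘ posteriorKernel B μ) ≠ ⊤ := by
  refine ne_top_of_le_ne_top ENNReal.one_ne_top ?_
  rw [← lintegral_invDensity B μ U]
  refine lintegral_mono fun q => ENNReal.ofReal_le_ofReal ?_
  linarith [one_sub_invDensity_le_infoDensity B μ q]

/-- The mutual information is nonnegative; it may be infinite here. -/
theorem extExpectation_infoDensity_nonneg :
    0 ≤ extExpectation (fun q => (infoDensity B μ q : EReal))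
      (obsLaw B μ U ⊗ₘ posteriorKernel B μ) := by
  have hi := integrable_invDensity B μ U
  have h : ∫ q, (1 - invDensity B μ q) ∂(obsLaw B μ U ⊗ₘ posteriorKernel B μ) = 0 := by
    rw [integral_sub (integrable_const _) hi, integral_eq_lintegral_of_nonneg_ae
      (ae_of_all _ (invDensity_nonneg B μ)) hi.1, lintegral_invDensity]
    simp
  have hi' : Integrable (fun q => 1 - invDensity B μ q) (obsLaw B μ U ⊗ₘ posteriorKernel B μ) :=
    (integrable_const (1 : ℝ)).sub hi
  have h' := extExpectation_coe_eq_integral hi'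
  rw [h] at h'
  rw [← EReal.coe_zero, ← h']
  exact extExpectation_mono (ae_of_all _ fun q =>
    EReal.coe_le_coe_iff.2 (one_sub_invDensity_le_infoDensity B μ q))

/-- Chain rule: the mean relative entropy of the posterior is mutual information plus the relative
entropy of the prior. Both negative parts are integrable, so this holds in `(-∞, ∞]`. -/
theorem extExpectation_relEntropy_posteriorKernel (ν : Measure E) [SigmaFinite ν] (hμν : μ ≪ ν)
    (hD : relEntropy μ ν ≠ ⊥) :
    extExpectation (fun θ => relEntropy (posteriorKernel B μ θ) ν) (obsLaw B μ U) =
      extExpectation (fun q => (infoDensity B μ q : EReal))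
        (obsLaw B μ U ⊗ₘ posteriorKernel B μ) + relEntropy μ ν := by
  have hDe : relEntropy μ ν = extExpectation (fun x => (llr μ ν x : EReal)) μ := if_pos hμν
  have hL : ∫⁻ x, ENNReal.ofReal (-llr μ ν x) ∂μ ≠ ⊤ :=
    lintegral_neg_ne_top_of_extExpectation_ne_bot (by rwa [← hDe])
  have hm1 := measurable_infoDensity B μ
  have hm2 : Measurable fun q : (E × ℝ) × E => llr μ ν q.2 := (measurable_llr μ ν).comp measurable_snd
  have hL' : ∫⁻ q, ENNReal.ofReal (-llr μ ν q.2) ∂(obsLaw B μ U ⊗ₘ posteriorKernel B μ) ≠ ⊤ := by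
    rwa [lintegral_joint_snd B μ U (f := fun x => ENNReal.ofReal (-llr μ ν x))
      (measurable_llr μ ν).neg.ennreal_ofReal]
  have hF := lintegral_neg_infoDensity_ne_top B μ U
  have hsnd : extExpectation (fun q => ((llr μ ν q.2 : ℝ) : EReal))
      (obsLaw B μ U ⊗ₘ posteriorKernel B μ) = relEntropy μ ν := by
    rw [hDe, extExpectation_coe, extExpectation_coe,
      lintegral_joint_snd B μ U (f := fun x => ENNReal.ofReal (llr μ ν x))
        (measurable_llr μ ν).ennreal_ofReal,
      lintegral_joint_snd B μ U (f := fun x => ENNReal.ofReal (-llr μ ν x))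
        (measurable_llr μ ν).neg.ennreal_ofReal]
  simp only [relEntropy_posteriorKernel B μ ν hμν]
  rw [extExpectation_compProd (f := fun q => infoDensity B μ q + llr μ ν q.2) (hm1.add hm2),
    extExpectation_add hm1.aemeasurable hm2.aemeasurable hF hL', hsnd]
  refine ne_top_of_le_ne_top (ENNReal.add_ne_top.2 ⟨hF, hL'⟩) ?_
  have hm1n : Measurable fun q => -infoDensity B μ q := hm1.neg
  rw [← lintegral_add_left hm1n.ennreal_ofReal]
  refine lintegral_mono fun q => ?_
  rw [neg_add]
  exact ENNReal.ofReal_add_le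

end Joint

end

/-! ### Gaussian upper bound for the mutual information -/

section

variable {E : Type*} [NormedAddCommGroup E] [InnerProductSpace ℝ E] [FiniteDimensional ℝ E]
  [MeasurableSpace E] [BorelSpace E]

/-- Change of variables in a shifted and linearly transformed Gaussian integral. -/
theorem gaussConst_mul_lintegral_symm_sub (T : E ≃L[ℝ] E) (w : E) :
    gaussConst E * ∫⁻ v : E, ENNReal.ofReal (Real.exp (-‖T.symm (v - w)‖ ^ 2 / 2)) =
      ENNReal.ofReal |LinearMap.det (T : E →ₗ[ℝ] E)| := by
  have hdet : LinearMap.det (T : E →ₗ[ℝ] E) ≠ 0 := T.toLinearEquiv.isUnit_det'.ne_zero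
  rw [lintegral_sub_right_eq_self (fun v : E => ENNReal.ofReal (Real.exp (-‖T.symm v‖ ^ 2 / 2))) w]
  have h := Measure.map_linearMap_addHaar_eq_smul_addHaar (volume : Measure E) hdet
  have hm : Measurable fun v : E => ENNReal.ofReal (Real.exp (-‖T.symm v‖ ^ 2 / 2)) := by fun_prop
  have h2 := congrArg (fun m => ∫⁻ v, ENNReal.ofReal (Real.exp (-‖T.symm v‖ ^ 2 / 2)) ∂m) h
  have hT : Measurable ((T : E →ₗ[ℝ] E) : E → E) := T.continuous.measurable
  simp only [lintegral_smul_measure] at h2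
  rw [lintegral_map hm hT] at h2
  have e : ∀ v, T.symm ((T : E →ₗ[ℝ] E) v) = v := fun v => T.symm_apply_apply v
  simp only [e, smul_eq_mul] at h2
  rw [abs_inv, ENNReal.ofReal_inv_of_pos (abs_pos.2 hdet)] at h2
  have h3 := congrArg (fun r => ENNReal.ofReal |LinearMap.det (T : E →ₗ[ℝ] E)| * (gaussConst E * r)) h2
  simp only [gaussConst_mul_lintegral, mul_one] at h3
  rw [h3, mul_left_comm (gaussConst E), ← mul_assoc, ENNReal.mul_inv_cancel, one_mul]
  · simpa using hdet
  · simp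

variable (B : E ≃L[ℝ] E) (μ : Measure E)

/-- The density with respect to `refMeasure` of a Gaussian observation `y` centred at `√τ m`, whose
covariance is that of `B T z` for all `τ`. It takes the place of the evidence. -/
def gaussianProxy (T : E ≃L[ℝ] E) (m : E) (θ : E × ℝ) : ℝ :=
  Real.exp (-‖T.symm (B.symm θ.1 - √θ.2 • B.symm m)‖ ^ 2 / 2) / |LinearMap.det (T : E →ₗ[ℝ] E)|

variable [IsProbabilityMeasure μ] (U : Measure ℝ) [IsProbabilityMeasure U] (T : E ≃L[ℝ] E) (m : E)

theorem abs_det_pos : 0 < |LinearMap.det (T : E →ₗ[ℝ] E)| :=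
  abs_pos.2 T.toLinearEquiv.isUnit_det'.ne_zero

theorem measurable_gaussianProxy : Measurable (gaussianProxy B T m) := by
  unfold gaussianProxy; fun_prop

theorem gaussianProxy_pos (θ : E × ℝ) : 0 < gaussianProxy B T m θ :=
  div_pos (Real.exp_pos _) (abs_det_pos T)

theorem lintegral_refMeasure_gaussianProxy :
    ∫⁻ θ, ENNReal.ofReal (gaussianProxy B T m θ) ∂(refMeasure B U) = 1 := by
  have hm := (measurable_gaussianProxy B T m).ennreal_ofReal
  rw [refMeasure, lintegral_prod_symm' _ hm]
  have : ∀ t : ℝ, ∫⁻ y, ENNReal.ofReal (gaussianProxy B T m (y, t))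
      ∂(gaussConst E • (volume : Measure E).map B) = 1 := fun t => by
    have hmt : Measurable fun y => ENNReal.ofReal (gaussianProxy B T m (y, t)) :=
      hm.comp measurable_prodMk_right
    rw [lintegral_smul_measure, lintegral_map hmt (by fun_prop), smul_eq_mul]
    simp only [gaussianProxy, ContinuousLinearEquiv.symm_apply_apply]
    simp only [ENNReal.ofReal_div_of_pos (abs_det_pos T), div_eq_mul_inv _ (ENNReal.ofReal _)]
    rw [lintegral_mul_const _ (by fun_prop), ← mul_assoc, gaussConst_mul_lintegral_symm_sub,
      ENNReal.mul_inv_cancel]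
    · simpa using (T.toLinearEquiv.isUnit_det'.ne_zero)
    · simp
  simp only [this]
  simp

/-- The ratio of the Gaussian density to the evidence. -/
def proxyRatio (q : (E × ℝ) × E) : ℝ := gaussianProxy B T m q.1 / (evidence B μ q.1).toReal

theorem measurable_proxyRatio : Measurable (proxyRatio B μ T m) :=
  ((measurable_gaussianProxy B T m).comp measurable_fst).div
    ((measurable_evidence B μ).ennreal_toReal.comp measurable_fst)

theorem evidence_toReal_pos (θ : E × ℝ) : 0 < (evidence B μ θ).toReal :=
  ENNReal.toReal_pos (evidence_ne_zero B μ θ) (evidence_ne_top B μ θ)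

theorem proxyRatio_pos (q : (E × ℝ) × E) : 0 < proxyRatio B μ T m q :=
  div_pos (gaussianProxy_pos B T m _) (evidence_toReal_pos B μ _)

/-- Under the law of the observation the evidence cancels. -/
theorem lintegral_proxyRatio : ∫⁻ q, ENNReal.ofReal (proxyRatio B μ T m q)
    ∂(obsLaw B μ U ⊗ₘ posteriorKernel B μ) = 1 := by
  have hm := (measurable_proxyRatio B μ T m).ennreal_ofReal
  have hg := measurable_gaussianProxy B T m
  have hZ := measurable_evidence B μ
  rw [Measure.lintegral_compProd hm]
  simp only [proxyRatio, lintegral_const, measure_univ, mul_one]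
  have hgZ : Measurable fun θ => ENNReal.ofReal (gaussianProxy B T m θ / (evidence B μ θ).toReal) :=
    (hg.div hZ.ennreal_toReal).ennreal_ofReal
  rw [obsLaw_eq_withDensity, lintegral_withDensity_eq_lintegral_mul _ hZ hgZ, ← lintegral_refMeasure_gaussianProxy B U T m]
  refine lintegral_congr fun θ => ?_
  rw [Pi.mul_apply, ENNReal.ofReal_div_of_pos (evidence_toReal_pos B μ θ),
    ENNReal.ofReal_toReal (evidence_ne_top B μ θ),
    ENNReal.mul_div_cancel (evidence_ne_zero B μ θ) (evidence_ne_top B μ θ)]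

/-- The quadratic form in the exponent of `gaussianProxy`. -/
def proxySq (q : (E × ℝ) × E) : ℝ := ‖T.symm (B.symm q.1.1 - √q.1.2 • B.symm m)‖ ^ 2

/-- The squared norm `‖z‖²` of the noise, expressed by observation and signal. -/
def noiseSq (q : (E × ℝ) × E) : ℝ := ‖B.symm q.1.1 - √q.1.2 • B.symm q.2‖ ^ 2

theorem measurable_proxySq : Measurable (proxySq B T m) := by
  unfold proxySq; fun_prop

theorem measurable_noiseSq : Measurable (noiseSq B) := by
  unfold noiseSq; fun_prop

theorem lintegral_noiseSq : ∫⁻ q, ENNReal.ofReal (noiseSq B q)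
    ∂(obsLaw B μ U ⊗ₘ posteriorKernel B μ) = ∫⁻ z, ENNReal.ofReal (‖z‖ ^ 2) ∂(stdGaussian E) := by
  have hm := (measurable_noiseSq B).ennreal_ofReal
  rw [Measure.lintegral_compProd hm, lintegral_obsLaw_posteriorKernel B μ U hm]
  simp [noiseSq]

theorem lintegral_proxySq : ∫⁻ q, ENNReal.ofReal (proxySq B T m q)
    ∂(obsLaw B μ U ⊗ₘ posteriorKernel B μ) =
      (∫⁻ t, ENNReal.ofReal t ∂U) * ∫⁻ x, ENNReal.ofReal (‖T.symm (B.symm (x - m))‖ ^ 2) ∂μ +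
      ∫⁻ z, ENNReal.ofReal (‖T.symm z‖ ^ 2) ∂(stdGaussian E) := by
  have hm := (measurable_proxySq B T m).ennreal_ofReal
  rw [Measure.lintegral_compProd hm, lintegral_obsLaw_posteriorKernel B μ U hm]
  have h1 : ∀ (t : ℝ) (x : E), ∫⁻ z, ENNReal.ofReal (proxySq B T m ((√t • x + B z, t), x))
      ∂(stdGaussian E) = ENNReal.ofReal t * ENNReal.ofReal (‖T.symm (B.symm (x - m))‖ ^ 2) +
      ∫⁻ z, ENNReal.ofReal (‖T.symm z‖ ^ 2) ∂(stdGaussian E) := fun t x => by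
    have := lintegral_norm_sq_add_clm (√t • T.symm (B.symm (x - m))) (T.symm : E →L[ℝ] E)
    rw [norm_smul, mul_pow, ENNReal.ofReal_mul (by positivity), Real.norm_eq_abs, sq_abs] at this
    have h2 : ENNReal.ofReal (√t ^ 2) = ENNReal.ofReal t := by
      -- `√t` and `ENNReal.ofReal t` both vanish for negative `t`.
      rcases le_total 0 t with h | h
      · rw [Real.sq_sqrt h]
      · rw [Real.sqrt_eq_zero_of_nonpos h, ENNReal.ofReal_of_nonpos h]; simp
    rw [h2] at this
    refine Eq.trans (lintegral_congr fun z => ?_) this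
    simp only [proxySq, map_add, map_smul, map_sub, ContinuousLinearEquiv.symm_apply_apply,
      ContinuousLinearEquiv.coe_coe]
    congr 3
    rw [smul_sub]
    abel
  simp only [h1]
  have h3 : ∀ t : ℝ, ∫⁻ x, (ENNReal.ofReal t * ENNReal.ofReal (‖T.symm (B.symm (x - m))‖ ^ 2) +
      ∫⁻ z, ENNReal.ofReal (‖T.symm z‖ ^ 2) ∂(stdGaussian E)) ∂μ =
      ENNReal.ofReal t * ∫⁻ x, ENNReal.ofReal (‖T.symm (B.symm (x - m))‖ ^ 2) ∂μ +
      ∫⁻ z, ENNReal.ofReal (‖T.symm z‖ ^ 2) ∂(stdGaussian E) := fun t => by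
    rw [lintegral_add_right _ measurable_const, lintegral_const_mul _ (by fun_prop)]
    simp
  simp only [h3]
  rw [lintegral_add_right _ measurable_const, lintegral_mul_const _ (by fun_prop)]
  simp

/-- Pointwise form of the Gibbs inequality, `log t ≤ t - 1` at `t = proxyRatio`. -/
theorem infoDensity_le (q : (E × ℝ) × E) : infoDensity B μ q ≤
    Real.log |LinearMap.det (T : E →ₗ[ℝ] E)| - 1 + proxySq B T m q / 2 - noiseSq B q / 2
      + proxyRatio B μ T m q := by
  have hd := abs_det_pos T
  have hZ := evidence_toReal_pos B μ q.1
  have h := Real.log_le_sub_one_of_pos (proxyRatio_pos B μ T m q)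
  rw [proxyRatio, Real.log_div (gaussianProxy_pos B T m _).ne' hZ.ne', gaussianProxy,
    Real.log_div (Real.exp_pos _).ne' hd.ne', Real.log_exp] at h
  rw [infoDensity, likelihood, Real.log_exp, proxySq, noiseSq, proxyRatio, gaussianProxy]
  linarith

/-- Bound on the mutual information by comparison with a Gaussian observation. The hypothesis `hT`
says that the Gaussian covariance, that of `B T z`, is large enough for all times up to `2`. -/
theorem extExpectation_infoDensity_le (hU : ∀ᵐ t ∂U, t ≤ 2)
    (hT : 2 * ∫⁻ x, ENNReal.ofReal (‖T.symm (B.symm (x - m))‖ ^ 2) ∂μ +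
      ∫⁻ z, ENNReal.ofReal (‖T.symm z‖ ^ 2) ∂(stdGaussian E) ≤
      ∫⁻ z, ENNReal.ofReal (‖z‖ ^ 2) ∂(stdGaussian E)) :
    extExpectation (fun q => (infoDensity B μ q : EReal)) (obsLaw B μ U ⊗ₘ posteriorKernel B μ) ≤
      ((Real.log |LinearMap.det (T : E →ₗ[ℝ] E)| : ℝ) : EReal) := by
  set J := obsLaw B μ U ⊗ₘ posteriorKernel B μ
  set N := ∫⁻ z, ENNReal.ofReal (‖z‖ ^ 2) ∂(stdGaussian E)
  have hN : N ≠ ⊤ := lintegral_norm_sq_stdGaussian_ne_top (ContinuousLinearMap.id ℝ E)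
  have hUint : ∫⁻ t, ENNReal.ofReal t ∂U ≤ 2 := by
    calc ∫⁻ t, ENNReal.ofReal t ∂U ≤ ∫⁻ _, 2 ∂U :=
          lintegral_mono_ae (hU.mono fun t ht => by
            simpa using ENNReal.ofReal_le_ofReal ht)
      _ = 2 := by simp
  have hS : ∫⁻ q, ENNReal.ofReal (proxySq B T m q) ∂J ≤ N := by
    rw [lintegral_proxySq]
    exact le_trans (by gcongr) hT
  have hV : ∫⁻ q, ENNReal.ofReal (noiseSq B q) ∂J = N := lintegral_noiseSq B μ U
  have hR : ∫⁻ q, ENNReal.ofReal (proxyRatio B μ T m q) ∂J = 1 := lintegral_proxyRatio B μ U T m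
  have nS : ∀ q, 0 ≤ proxySq B T m q := fun q => sq_nonneg _
  have nV : ∀ q, 0 ≤ noiseSq B q := fun q => sq_nonneg _
  have nR : ∀ q, 0 ≤ proxyRatio B μ T m q := fun q => (proxyRatio_pos B μ T m q).le
  have iS : Integrable (proxySq B T m) J := by
    refine ⟨(measurable_proxySq B T m).aestronglyMeasurable, ?_⟩
    rw [hasFiniteIntegral_iff_ofReal (ae_of_all _ nS)]
    exact hS.trans_lt hN.lt_top
  have iV : Integrable (noiseSq B) J := by
    refine ⟨(measurable_noiseSq B).aestronglyMeasurable, ?_⟩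
    rw [hasFiniteIntegral_iff_ofReal (ae_of_all _ nV), hV]
    exact hN.lt_top
  have iR : Integrable (proxyRatio B μ T m) J := by
    refine ⟨(measurable_proxyRatio B μ T m).aestronglyMeasurable, ?_⟩
    rw [hasFiniteIntegral_iff_ofReal (ae_of_all _ nR), hR]
    exact ENNReal.one_lt_top
  have eS : ∫ q, proxySq B T m q ∂J ≤ N.toReal := by
    rw [integral_eq_lintegral_of_nonneg_ae (ae_of_all _ nS) iS.1]
    exact ENNReal.toReal_mono hN hS
  have eV : ∫ q, noiseSq B q ∂J = N.toReal := by
    rw [integral_eq_lintegral_of_nonneg_ae (ae_of_all _ nV) iV.1, hV]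
  have eR : ∫ q, proxyRatio B μ T m q ∂J = 1 := by
    rw [integral_eq_lintegral_of_nonneg_ae (ae_of_all _ nR) iR.1, hR]; simp
  set c := Real.log |LinearMap.det (T : E →ₗ[ℝ] E)|
  have i1 : Integrable (fun q => c - 1 + proxySq B T m q / 2) J :=
    (integrable_const _).add (iS.div_const 2)
  have i2 : Integrable (fun q => c - 1 + proxySq B T m q / 2 - noiseSq B q / 2) J :=
    i1.sub (iV.div_const 2)
  have i3 : Integrable (fun q => c - 1 + proxySq B T m q / 2 - noiseSq B q / 2
      + proxyRatio B μ T m q) J := i2.add iR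
  refine (extExpectation_mono (ae_of_all _ fun q =>
    EReal.coe_le_coe_iff.2 (infoDensity_le B μ T m q))).trans ?_
  rw [extExpectation_coe_eq_integral i3, EReal.coe_le_coe_iff, integral_add i2 iR,
    integral_sub i1 (iV.div_const 2), integral_add (integrable_const _) (iS.div_const 2),
    integral_div, integral_div, eV, eR]
  simp only [integral_const, probReal_univ, smul_eq_mul, one_mul]
  linarith

end

/-! ### Decay of the posterior variance -/

section

theorem evariance_le_lintegral_sq_sub {Ω : Type*} [MeasurableSpace Ω] (ρ : Measure Ω)
    [IsProbabilityMeasure ρ] {X : Ω → ℝ} (hX : AEStronglyMeasurable X ρ) (c : ℝ) :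
    eVar[X; ρ] ≤ ∫⁻ ω, ENNReal.ofReal ((X ω - c) ^ 2) ∂ρ := by
  by_cases h : ∫⁻ ω, ENNReal.ofReal ((X ω - c) ^ 2) ∂ρ = ⊤
  · rw [h]; exact le_top
  have hXc : AEStronglyMeasurable (fun ω => X ω - c) ρ := hX.sub aestronglyMeasurable_const
  have hi : Integrable (fun ω => (X ω - c) ^ 2) ρ := by
    refine ⟨hXc.pow 2, ?_⟩
    rw [hasFiniteIntegral_iff_ofReal (ae_of_all _ fun ω => sq_nonneg _)]
    exact lt_top_iff_ne_top.2 h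
  have hm : MemLp (fun ω => X ω - c) 2 ρ := (memLp_two_iff_integrable_sq hXc).2 hi
  have hm' : MemLp X 2 ρ := by
    have := hm.add (memLp_const c)
    simpa [Pi.add_def] using this
  rw [← ofReal_integral_eq_lintegral_ofReal hi (ae_of_all _ fun _ => sq_nonneg _),
    ← hm'.ofReal_variance_eq]
  refine ENNReal.ofReal_le_ofReal ?_
  rw [← variance_sub_const hX c]
  exact variance_le_expectation_sq hXc

variable {E : Type*} [NormedAddCommGroup E] [InnerProductSpace ℝ E] [FiniteDimensional ℝ E]
  [MeasurableSpace E] [BorelSpace E]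

variable (B : E ≃L[ℝ] E) (μ : Measure E)

theorem lintegral_obsLaw [IsProbabilityMeasure μ] (U : Measure ℝ) [IsProbabilityMeasure U]
    {f : E × ℝ → ℝ≥0∞} (hf : Measurable f) :
    ∫⁻ θ, f θ ∂(obsLaw B μ U) = ∫⁻ t, ∫⁻ x, ∫⁻ z, f (√t • x + B z, t) ∂(stdGaussian E) ∂μ ∂U := by
  have := lintegral_obsLaw_posteriorKernel B μ U (f := fun q => f q.1) (by fun_prop)
  simpa using this

theorem measurable_lintegral_obsLaw_dirac [IsProbabilityMeasure μ] {f : E × ℝ → ℝ≥0∞}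
    (hf : Measurable f) : Measurable fun s => ∫⁻ θ, f θ ∂(obsLaw B μ (Measure.dirac s)) := by
  have h : ∀ s : ℝ, ∫⁻ θ, f θ ∂(obsLaw B μ (Measure.dirac s)) =
      ∫⁻ p, f (channelMap B (p, s)) ∂(μ.prod (stdGaussian E)) := fun s => by
    have hm : Measurable fun p : E × E => f (channelMap B (p, s)) :=
      (hf.comp (measurable_channelMap B)).comp measurable_prodMk_right
    have hm2 : Measurable fun t => ∫⁻ x, ∫⁻ z, f (√t • x + B z, t) ∂(stdGaussian E) ∂μ := by fun_prop
    rw [lintegral_obsLaw B μ _ hf, lintegral_dirac' _ hm2, lintegral_prod _ hm.aemeasurable]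
    rfl
  simp only [h]
  exact (hf.comp (measurable_channelMap B)).lintegral_prod_left'

theorem lintegral_obsLaw_eq_lintegral_dirac [IsProbabilityMeasure μ] (U : Measure ℝ)
    [IsProbabilityMeasure U] {f : E × ℝ → ℝ≥0∞} (hf : Measurable f) :
    ∫⁻ θ, f θ ∂(obsLaw B μ U) = ∫⁻ s, ∫⁻ θ, f θ ∂(obsLaw B μ (Measure.dirac s)) ∂U := by
  rw [lintegral_obsLaw B μ U hf]
  refine lintegral_congr fun s => ?_
  have hm2 : Measurable fun t => ∫⁻ x, ∫⁻ z, f (√t • x + B z, t) ∂(stdGaussian E) ∂μ := by fun_prop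
  rw [lintegral_obsLaw B μ _ hf, lintegral_dirac' _ hm2]

variable [IsProbabilityMeasure μ]

/-- The posterior has bounded density with respect to the prior, hence inherits its moments. -/
theorem memLp_posteriorKernel (hμ : MemLp id 2 μ) (θ : E × ℝ) :
    MemLp id 2 (posteriorKernel B μ θ) := by
  have hle : posteriorKernel B μ θ ≤ (evidence B μ θ)⁻¹ • μ := by
    rw [posteriorKernel_apply, ← withDensity_const]
    refine withDensity_mono (ae_of_all _ fun x => ?_)
    simp only [div_eq_mul_inv]
    calc _ ≤ 1 * (evidence B μ θ)⁻¹ := by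
          gcongr; exact ENNReal.ofReal_le_one.2 (likelihood_le_one B θ x)
      _ = _ := one_mul _
  exact (hμ.smul_measure (ENNReal.inv_ne_top.2 (evidence_ne_zero B μ θ))).mono_measure hle

/-- The posterior mean of the signal. -/
def postMean (θ : E × ℝ) : E := ∫ x, x ∂(posteriorKernel B μ θ)

theorem measurable_postMean : Measurable (postMean B μ) :=
  (StronglyMeasurable.integral_kernel (κ := posteriorKernel B μ) stronglyMeasurable_id).measurable

theorem evariance_inner_posteriorKernel (hμ : MemLp id 2 μ) (θ : E × ℝ) (v : E) :
    eVar[fun x => inner ℝ v x; posteriorKernel B μ θ] =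
      ∫⁻ x, ENNReal.ofReal (inner ℝ v (x - postMean B μ θ) ^ 2) ∂(posteriorKernel B μ θ) := by
  rw [evariance_eq_lintegral_ofReal]
  have hi : Integrable (fun x : E => x) (posteriorKernel B μ θ) :=
    (memLp_posteriorKernel B μ hμ θ).integrable (by norm_num)
  rw [integral_inner hi]
  simp only [postMean, inner_sub_right]

theorem measurable_evariance_posteriorKernel (hμ : MemLp id 2 μ) {v : E × ℝ → E} (hv : Measurable v) :
    Measurable fun θ => eVar[fun x => inner ℝ (v θ) x; posteriorKernel B μ θ] := by
  simp only [evariance_inner_posteriorKernel B μ hμ]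
  have hm := measurable_postMean B μ
  refine Measurable.lintegral_kernel_prod_right' (κ := posteriorKernel B μ)
    (f := fun q : (E × ℝ) × E => ENNReal.ofReal (inner ℝ (v q.1) (q.2 - postMean B μ q.1) ^ 2)) ?_
  fun_prop

/-- The expected posterior variance of `⟪u, x⟫` when the observation is made at the fixed time `s`,
that is, the minimal mean square error of an estimator of `⟪u, x⟫`. -/
def mmse (u : E) (s : ℝ) : ℝ≥0∞ :=
  ∫⁻ θ, eVar[fun x => inner ℝ u x; posteriorKernel B μ θ] ∂(obsLaw B μ (Measure.dirac s))

theorem mmse_le_estimator (u : E) (s : ℝ) {e : E → ℝ} (he : Measurable e) :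
    mmse B μ u s ≤ ∫⁻ x, ∫⁻ z, ENNReal.ofReal ((inner ℝ u x - e (√s • x + B z)) ^ 2)
      ∂(stdGaussian E) ∂μ := by
  calc mmse B μ u s ≤ ∫⁻ θ, ∫⁻ x, ENNReal.ofReal ((inner ℝ u x - e θ.1) ^ 2)
        ∂(posteriorKernel B μ θ) ∂(obsLaw B μ (Measure.dirac s)) := by
        refine lintegral_mono fun θ => evariance_le_lintegral_sq_sub _ ?_ _
        exact Continuous.aestronglyMeasurable (by fun_prop)
    _ = _ := by
      rw [lintegral_obsLaw_posteriorKernel B μ _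
        (f := fun q => ENNReal.ofReal ((inner ℝ u q.2 - e q.1.1) ^ 2)) (by fun_prop)]
      rw [lintegral_dirac' _ (by fun_prop)]

theorem mmse_le_evariance (u : E) (s : ℝ) : mmse B μ u s ≤ eVar[fun x => inner ℝ u x; μ] := by
  refine (mmse_le_estimator B μ u s (e := fun _ => ∫ x, inner ℝ u x ∂μ) measurable_const).trans ?_
  simp [evariance_eq_lintegral_ofReal]

/-- Rotation invariance of a pair of independent standard Gaussian vectors. -/
theorem lintegral_stdGaussian_rotation {c e : ℝ} (hc : 0 ≤ c) (he : 0 ≤ e) (h : c ^ 2 + e ^ 2 = 1)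
    {f : E × E → ℝ≥0∞} (hf : Measurable f) :
    ∫⁻ w, ∫⁻ z, f (c • z + e • w, e • z - c • w) ∂(stdGaussian E) ∂(stdGaussian E) =
      ∫⁻ z, ∫⁻ w, f (z, w) ∂(stdGaussian E) ∂(stdGaussian E) := by
  have hrot := IsGaussian.map_rotation_eq_self (μ := stdGaussian E) (by simp) (Real.arccos e)
  have hs : Real.sin (Real.arccos e) = c := by
    rw [Real.sin_arccos, ← h, add_sub_cancel_right, Real.sqrt_sq hc]
  have hcs : Real.cos (Real.arccos e) = e :=
    Real.cos_arccos (by linarith) (by nlinarith)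
  have h2 := congrArg (fun m => ∫⁻ p, f p ∂m) hrot
  have hfr : Measurable fun p => f (ContinuousLinearMap.rotation (Real.arccos e) p) :=
    hf.comp (ContinuousLinearMap.continuous _).measurable
  rw [lintegral_map hf (ContinuousLinearMap.continuous _).measurable, lintegral_prod _ hfr.aemeasurable,
    lintegral_prod _ hf.aemeasurable] at h2
  rw [← h2]
  refine lintegral_congr fun w => lintegral_congr fun z => ?_
  simp only [ContinuousLinearMap.rotation_apply, hs, hcs]
  congr 2
  · abel
  · rw [neg_smul]; abel

/-- The error at time `s + δ` is at most that of the following estimator. The observation at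
`s + δ`, with the help of independent noise, is converted into an observation at time `s` and an
independent observation of strength `δ`; the posterior mean at time `s` is then corrected linearly,
with coefficient `√δ a`, by the innovation of the second observation. -/
theorem mmse_add_le (hμ : MemLp id 2 μ) (u : E) {s δ : ℝ} (hs : 0 ≤ s) (hδ : 0 < δ)
    {a : E × ℝ → E} (ha : Measurable a) :
    mmse B μ u (s + δ) ≤ ∫⁻ θ, (eVar[fun x => inner ℝ (u - δ • a θ) x; posteriorKernel B μ θ] +
      ENNReal.ofReal δ * ∫⁻ z, ENNReal.ofReal (inner ℝ (a θ) (B z) ^ 2) ∂(stdGaussian E))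
        ∂(obsLaw B μ (Measure.dirac s)) := by
  have hm := measurable_postMean B μ
  set γ := stdGaussian E
  set t := s + δ with ht
  have ht0 : 0 < t := by positivity
  set c := √s / √t with hc
  set e := √δ / √t with he
  have hce : c ^ 2 + e ^ 2 = 1 := by
    rw [hc, he, div_pow, div_pow, Real.sq_sqrt hs, Real.sq_sqrt hδ.le, Real.sq_sqrt ht0.le,
      ← add_div, ← ht, div_self ht0.ne']
  have hct : c * √t = √s := div_mul_cancel₀ _ (Real.sqrt_pos.2 ht0).ne'
  have het : e * √t = √δ := div_mul_cancel₀ _ (Real.sqrt_pos.2 ht0).ne'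
  set est : E × E → ℝ := fun p => inner ℝ u (postMean B μ (p.1, s)) +
    √δ * inner ℝ (a (p.1, s)) (p.2 - √δ • postMean B μ (p.1, s)) with hest
  have hestm : Measurable est := by fun_prop
  -- For each value `w` of the auxiliary noise, `est` becomes an estimator based on the observation
  -- at time `t` alone.
  have h1 : ∀ w : E, mmse B μ u t ≤ ∫⁻ x, ∫⁻ z, ENNReal.ofReal ((inner ℝ u x -
      est (√s • x + B (c • z + e • w), √δ • x + B (e • z - c • w))) ^ 2) ∂γ ∂μ := fun w => by
    refine (mmse_le_estimator B μ u t
      (e := fun y => est (c • y + e • B w, e • y - c • B w)) (by fun_prop)).trans_eq ?_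
    refine lintegral_congr fun x => lintegral_congr fun z => ?_
    have e1 : c • (√t • x + B z) + e • B w = √s • x + B (c • z + e • w) := by
      rw [smul_add, smul_smul, hct, map_add, map_smul, map_smul]; abel
    have e2 : e • (√t • x + B z) - c • B w = √δ • x + B (e • z - c • w) := by
      rw [smul_add, smul_smul, het, map_sub, map_smul, map_smul]; abel
    rw [e1, e2]
  have h2 : mmse B μ u t ≤ ∫⁻ w, ∫⁻ x, ∫⁻ z, ENNReal.ofReal ((inner ℝ u x -
      est (√s • x + B (c • z + e • w), √δ • x + B (e • z - c • w))) ^ 2) ∂γ ∂μ ∂γ := by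
    calc mmse B μ u t = ∫⁻ _, mmse B μ u t ∂γ := by simp [γ]
      _ ≤ _ := lintegral_mono h1
  refine h2.trans_eq ?_
  rw [lintegral_lintegral_swap (Measurable.aemeasurable (by fun_prop))]
  have h3 : ∀ x, ∫⁻ w, ∫⁻ z, ENNReal.ofReal ((inner ℝ u x -
      est (√s • x + B (c • z + e • w), √δ • x + B (e • z - c • w))) ^ 2) ∂γ ∂γ =
      ∫⁻ z, ∫⁻ w, ENNReal.ofReal ((inner ℝ u x - est (√s • x + B z, √δ • x + B w)) ^ 2) ∂γ ∂γ :=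
    fun x => lintegral_stdGaussian_rotation (by positivity) (by positivity) hce
      (f := fun p => ENNReal.ofReal ((inner ℝ u x - est (√s • x + B p.1, √δ • x + B p.2)) ^ 2))
      (by fun_prop)
  simp only [h3]
  set K : (E × ℝ) × E → ℝ≥0∞ := fun q =>
    ENNReal.ofReal (inner ℝ (u - δ • a q.1) (q.2 - postMean B μ q.1) ^ 2) +
      ENNReal.ofReal δ * ∫⁻ z, ENNReal.ofReal (inner ℝ (a q.1) (B z) ^ 2) ∂γ with hK
  have hKm : Measurable K := by fun_prop
  -- The error of `est` is `⟪u - δ a, x - postMean⟫ - √δ ⟪a, B w⟫`; the noise `w` is integrated out.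
  have h4 : ∀ x z, ∫⁻ w, ENNReal.ofReal ((inner ℝ u x - est (√s • x + B z, √δ • x + B w)) ^ 2) ∂γ =
      K ((√s • x + B z, s), x) := fun x z => by
    set θ : E × ℝ := (√s • x + B z, s)
    have := lintegral_norm_sq_add_clm (inner ℝ (u - δ • a θ) (x - postMean B μ θ))
      (-(√δ • (innerSL ℝ (a θ)).comp (B : E →L[ℝ] E)))
    simp only [Real.norm_eq_abs, sq_abs] at this
    refine Eq.trans (lintegral_congr fun w => ?_) (this.trans ?_)
    · congr 2
      simp only [hest, θ, neg_apply, smul_apply,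
        ContinuousLinearMap.comp_apply, innerSL_apply_apply, ContinuousLinearEquiv.coe_coe, smul_eq_mul,
        inner_sub_left, inner_sub_right, inner_add_right, inner_smul_left, inner_smul_right]
      simp only [RCLike.conj_to_real]
      have := Real.mul_self_sqrt hδ.le
      linear_combination (-(inner ℝ (a (√s • x + B z, s)) x)
        + inner ℝ (a (√s • x + B z, s)) (postMean B μ (√s • x + B z, s))) * this
    · simp only [hK]
      congr 1
      rw [← lintegral_const_mul _ (by fun_prop)]
      refine lintegral_congr fun w => ?_
      rw [← ENNReal.ofReal_mul hδ.le]
      congr 1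
      simp only [neg_apply, smul_apply,
        ContinuousLinearMap.comp_apply, innerSL_apply_apply, ContinuousLinearEquiv.coe_coe, smul_eq_mul]
      rw [neg_sq, mul_pow, Real.sq_sqrt hδ.le]
  simp only [h4]
  have h5 := lintegral_obsLaw_posteriorKernel B μ (Measure.dirac s) hKm
  rw [lintegral_dirac' _ (by fun_prop)] at h5
  rw [← h5]
  refine lintegral_congr fun θ => ?_
  simp only [hK]
  rw [lintegral_add_right _ measurable_const, evariance_inner_posteriorKernel B μ hμ]
  simp

/-- A bounded function `D` that decreases at rate at least `Ψ`, up to second order in the step,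
controls the integral of `Ψ` over `[1, 2]`: averaged over `s ∈ [1, 2]`, the difference
`D s - D (s + δ)` is at most the integral of `D` over `[1, 1 + δ]`, because the rest telescopes. -/
theorem lintegral_le_of_dissipation {D Ψ : ℝ → ℝ≥0∞} (hD : Measurable D) (hΨ : Measurable Ψ)
    {V K : ℝ≥0∞} (hV : V ≠ ⊤) (hK : K ≠ ⊤) (hDV : ∀ s, D s ≤ V)
    (h : ∀ s δ, 0 ≤ s → 0 < δ → D (s + δ) + ENNReal.ofReal δ * Ψ s ≤
      D s + ENNReal.ofReal (δ ^ 2) * K) :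
    ∫⁻ s in Set.Icc 1 2, Ψ s ≤ V := by
  have key : ∀ δ : ℝ, 0 < δ → δ < 1 → ∫⁻ s in Set.Icc 1 2, Ψ s ≤ V + ENNReal.ofReal δ * K := by
    intro δ hδ hδ1
    have hvol : (volume (Set.Icc (1 : ℝ) 2)) = 1 := by simp; norm_num
    have e1 : ∫⁻ s in Set.Icc 1 2, D (s + δ) = ∫⁻ s in Set.Icc (1 + δ) (2 + δ), D s := by
      have hmp : MeasurePreserving (fun s : ℝ => s + δ) volume volume :=
        measurePreserving_add_right volume δ
      rw [← hmp.setLIntegral_comp_preimage measurableSet_Icc hD]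
      simp
    have h1 : (∫⁻ s in Set.Icc (1 + δ) (2 + δ), D s) + ENNReal.ofReal δ * ∫⁻ s in Set.Icc 1 2, Ψ s ≤
        (∫⁻ s in Set.Icc 1 2, D s) + ENNReal.ofReal (δ ^ 2) * K := by
      rw [← e1, ← lintegral_const_mul _ hΨ, ← lintegral_add_left (by fun_prop)]
      calc _ ≤ ∫⁻ s in Set.Icc 1 2, (D s + ENNReal.ofReal (δ ^ 2) * K) :=
            setLIntegral_mono (by fun_prop) fun s hs => h s δ (by linarith [hs.1]) hδ
        _ = _ := by rw [lintegral_add_right _ measurable_const]; simp [hvol]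
    have h2 : ∫⁻ s in Set.Icc 1 2, D s ≤ ENNReal.ofReal δ * V + ∫⁻ s in Set.Icc (1 + δ) (2 + δ), D s := by
      calc ∫⁻ s in Set.Icc 1 2, D s ≤ ∫⁻ s in Set.Icc 1 (1 + δ) ∪ Set.Icc (1 + δ) (2 + δ), D s :=
            lintegral_mono_set fun s hs => by
              rcases le_total s (1 + δ) with hs' | hs'
              · exact Or.inl ⟨hs.1, hs'⟩
              · exact Or.inr ⟨hs', by linarith [hs.2]⟩
        _ ≤ (∫⁻ s in Set.Icc 1 (1 + δ), D s) + ∫⁻ s in Set.Icc (1 + δ) (2 + δ), D s :=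
            lintegral_union_le _ _ _
        _ ≤ _ := by
            gcongr
            calc ∫⁻ s in Set.Icc 1 (1 + δ), D s ≤ ∫⁻ s in Set.Icc 1 (1 + δ), V :=
                  lintegral_mono fun s => hDV s
              _ = _ := by simp [mul_comm]
    have hfin : ∫⁻ s in Set.Icc (1 + δ) (2 + δ), D s ≠ ⊤ := by
      refine ne_top_of_le_ne_top hV ?_
      calc _ ≤ ∫⁻ s in Set.Icc (1 + δ) (2 + δ), V := lintegral_mono fun s => hDV s
        _ = V := by simp; norm_num
    have h3 : ENNReal.ofReal δ * ∫⁻ s in Set.Icc 1 2, Ψ s ≤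
        ENNReal.ofReal δ * V + ENNReal.ofReal (δ ^ 2) * K := by
      refine (ENNReal.add_le_add_iff_left hfin).1 (h1.trans ?_)
      calc _ ≤ (ENNReal.ofReal δ * V + ∫⁻ s in Set.Icc (1 + δ) (2 + δ), D s) +
            ENNReal.ofReal (δ ^ 2) * K := by gcongr
        _ = _ := by ring
    rw [sq, ENNReal.ofReal_mul hδ.le, mul_assoc, ← mul_add] at h3
    exact (ENNReal.mul_le_mul_iff_right (by simpa using hδ) ENNReal.ofReal_ne_top).1 h3
  have hlim : Filter.Tendsto (fun δ : ℝ => V + ENNReal.ofReal δ * K) (nhdsWithin 0 (Set.Ioi 0))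
      (nhds (V + ENNReal.ofReal 0 * K)) :=
    tendsto_const_nhds.add (ENNReal.Tendsto.mul_const
      ((ENNReal.continuous_ofReal.tendsto 0).mono_left nhdsWithin_le_nhds) (Or.inr hK))
  simp only [ENNReal.ofReal_zero, zero_mul, add_zero] at hlim
  refine ge_of_tendsto hlim ?_
  filter_upwards [Ioo_mem_nhdsGT (zero_lt_one' ℝ)] with δ hδ
  exact key δ hδ.1 hδ.2

end

/-! ### Covariance matrices and linear maps of Euclidean space -/

section

open Matrix

variable {n : ℕ}

theorem inner_eq_sum (v x : EuclideanSpace ℝ (Fin n)) : inner ℝ v x = ∑ i, v i * x i := by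
  simp [PiLp.inner_apply, mul_comm]

theorem memLp_eval {ρ : Measure (EuclideanSpace ℝ (Fin n))} (h : MemLp id 2 ρ) (i : Fin n) :
    MemLp (fun v : EuclideanSpace ℝ (Fin n) => v i) 2 ρ :=
  (EuclideanSpace.proj (𝕜 := ℝ) i).comp_memLp' h

theorem variance_inner_eq_dotProduct {ρ : Measure (EuclideanSpace ℝ (Fin n))} [IsProbabilityMeasure ρ]
    (h : MemLp id 2 ρ) (v : EuclideanSpace ℝ (Fin n)) :
    Var[fun x => inner ℝ v x; ρ] = v.ofLp ⬝ᵥ Cov ρ *ᵥ v.ofLp := by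
  have hm : ∀ i, MemLp (fun x : EuclideanSpace ℝ (Fin n) => v i * x i) 2 ρ := fun i =>
    (memLp_eval h i).const_mul _
  simp only [inner_eq_sum]
  rw [← covariance_self (by fun_prop), covariance_fun_sum_fun_sum hm hm]
  simp only [covariance_const_mul_left, covariance_const_mul_right, dotProduct, mulVec, Cov, of_apply,
    Finset.mul_sum]
  refine Finset.sum_congr rfl fun i _ => Finset.sum_congr rfl fun j _ => by ring

theorem evariance_inner_eq_dotProduct {ρ : Measure (EuclideanSpace ℝ (Fin n))}
    [IsProbabilityMeasure ρ] (h : MemLp id 2 ρ) (v : EuclideanSpace ℝ (Fin n)) :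
    eVar[fun x => inner ℝ v x; ρ] = ENNReal.ofReal (v.ofLp ⬝ᵥ Cov ρ *ᵥ v.ofLp) := by
  rw [← variance_inner_eq_dotProduct h, MemLp.ofReal_variance_eq]
  exact (innerSL ℝ v).comp_memLp' h

theorem posSemidef_Cov {ρ : Measure (EuclideanSpace ℝ (Fin n))} [IsProbabilityMeasure ρ]
    (h : MemLp id 2 ρ) : (Cov ρ).PosSemidef := by
  refine PosSemidef.of_dotProduct_mulVec_nonneg ?_ fun v => ?_
  · ext i j
    simp [Cov, covariance_comm]
  · rw [star_trivial]
    have := variance_inner_eq_dotProduct h (WithLp.toLp 2 v)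
    simp only at this
    rw [← this]
    exact variance_nonneg _ _

theorem measurable_Cov_kernel {α : Type*} [MeasurableSpace α]
    (κ : Kernel α (EuclideanSpace ℝ (Fin n))) [IsSFiniteKernel κ] (i j : Fin n) :
    Measurable fun a => Cov (κ a) i j := by
  have hm : ∀ i : Fin n, Measurable fun a => ∫ x, x i ∂(κ a) := fun i =>
    (StronglyMeasurable.integral_kernel (κ := κ) (f := fun x : EuclideanSpace ℝ (Fin n) => x i)
      (Measurable.stronglyMeasurable (by fun_prop))).measurable
  simp only [Cov, of_apply, covariance]
  refine (StronglyMeasurable.integral_kernel_prod_right' (κ := κ)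
    (f := fun p : α × EuclideanSpace ℝ (Fin n) =>
      (p.2 i - ∫ x, x i ∂(κ p.1)) * (p.2 j - ∫ x, x j ∂(κ p.1))) ?_).measurable
  have h1 : Measurable fun p : α × EuclideanSpace ℝ (Fin n) => ∫ x, x i ∂(κ p.1) :=
    (hm i).comp measurable_fst
  have h2 : Measurable fun p : α × EuclideanSpace ℝ (Fin n) => ∫ x, x j ∂(κ p.1) :=
    (hm j).comp measurable_fst
  have e1 : Measurable fun p : α × EuclideanSpace ℝ (Fin n) => p.2 i := by fun_prop
  have e2 : Measurable fun p : α × EuclideanSpace ℝ (Fin n) => p.2 j := by fun_prop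
  exact ((e1.sub h1).mul (e2.sub h2)).stronglyMeasurable

/-- A bound in the positive semidefinite order follows from the bounds on all quadratic forms. -/
theorem integrable_and_expMatrix_le {Ω : Type*} [MeasurableSpace Ω] {P : Measure Ω}
    {M : Ω → Matrix (Fin n) (Fin n) ℝ} {A : Matrix (Fin n) (Fin n) ℝ}
    (hM : ∀ i j, AEStronglyMeasurable (fun ω => M ω i j) P) (hpsd : ∀ᵐ ω ∂P, (M ω).PosSemidef)
    (hA : A.PosSemidef)
    (h : ∀ u : Fin n → ℝ, ∫⁻ ω, ENNReal.ofReal (u ⬝ᵥ M ω *ᵥ u) ∂P ≤ ENNReal.ofReal (u ⬝ᵥ A *ᵥ u)) :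
    (∀ i j, Integrable (fun ω => M ω i j) P) ∧ expMatrix P M ≤ A := by
  have hsym : ∀ᵐ ω ∂P, ∀ i j, M ω i j = M ω j i := hpsd.mono fun ω hω i j => by
    have := hω.1.apply j i
    simpa using this
  have hnn : ∀ u : Fin n → ℝ, 0 ≤ᵐ[P] fun ω => u ⬝ᵥ M ω *ᵥ u := fun u => hpsd.mono fun ω hω => by
    have := hω.dotProduct_mulVec_nonneg u
    simpa using this
  have hq : ∀ u : Fin n → ℝ, Integrable (fun ω => u ⬝ᵥ M ω *ᵥ u) P := fun u => by
    refine ⟨?_, ?_⟩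
    · simp only [dotProduct, mulVec]
      fun_prop
    · rw [hasFiniteIntegral_iff_ofReal (hnn u)]
      exact (h u).trans_lt ENNReal.ofReal_lt_top
  have hi : ∀ i j, Integrable (fun ω => M ω i j) P := fun i j => by
    -- polarization
    have := ((hq (Pi.single i 1 + Pi.single j 1)).sub (hq (Pi.single i 1))).sub (hq (Pi.single j 1))
    refine (this.div_const 2).congr ?_
    filter_upwards [hsym] with ω hω
    simp only [Pi.sub_apply, mulVec_add, add_dotProduct, dotProduct_add, single_one_dotProduct,
      mulVec_single_one, col_apply]
    rw [hω j i]
    ring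
  refine ⟨hi, Matrix.le_iff.2 (PosSemidef.of_dotProduct_mulVec_nonneg ?_ fun u => ?_)⟩
  · refine hA.1.sub ?_
    ext i j
    simp only [conjTranspose_apply, expMatrix, of_apply, star_trivial]
    exact integral_congr_ae (hsym.mono fun ω hω => hω j i)
  · rw [star_trivial, sub_mulVec, dotProduct_sub, sub_nonneg]
    have e : u ⬝ᵥ expMatrix P M *ᵥ u = ∫ ω, u ⬝ᵥ M ω *ᵥ u ∂P := by
      simp only [dotProduct, mulVec, expMatrix, of_apply, Finset.mul_sum]
      rw [integral_finsetSum _ fun i _ => integrable_finsetSum _ fun j _ =>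
        ((hi i j).mul_const _).const_mul _]
      refine Finset.sum_congr rfl fun i _ => ?_
      rw [integral_finsetSum _ fun j _ => ((hi i j).mul_const _).const_mul _]
      refine Finset.sum_congr rfl fun j _ => ?_
      rw [integral_const_mul, integral_mul_const]
    rw [e]
    have hA' : 0 ≤ u ⬝ᵥ A *ᵥ u := by simpa using hA.dotProduct_mulVec_nonneg u
    rw [← ENNReal.ofReal_le_ofReal_iff hA', ofReal_integral_eq_lintegral_ofReal (hq u) (hnn u)]
    exact h u

theorem Cov_stdGaussian : Cov (stdGaussian (EuclideanSpace ℝ (Fin n))) = 1 := by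
  ext i j
  have := covariance_eval_multivariateGaussian (μ := (0 : EuclideanSpace ℝ (Fin n)))
    (S := (1 : Matrix (Fin n) (Fin n) ℝ)) PosSemidef.one i j
  rw [multivariateGaussian_zero_one] at this
  exact this

/-- The covariance of the noise `Q^{1/2} z` is `Q`. -/
theorem lintegral_inner_sqrt_sq {Q : Matrix (Fin n) (Fin n) ℝ} (hQ : Q.PosSemidef)
    (a : EuclideanSpace ℝ (Fin n)) :
    ∫⁻ z, ENNReal.ofReal (inner ℝ a (toEuclideanCLM (𝕜 := ℝ) (CFC.sqrt Q) z) ^ 2)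
      ∂(stdGaussian (EuclideanSpace ℝ (Fin n))) = ENNReal.ofReal (a.ofLp ⬝ᵥ Q *ᵥ a.ofLp) := by
  set L : StrongDual ℝ (EuclideanSpace ℝ (Fin n)) :=
    (innerSL ℝ a).comp (toEuclideanCLM (𝕜 := ℝ) (CFC.sqrt Q))
  have hsa : IsSelfAdjoint (toEuclideanCLM (n := Fin n) (𝕜 := ℝ) (CFC.sqrt Q)) :=
    (CFC.sqrt_nonneg Q).isSelfAdjoint.map _
  have hL : L = innerSL ℝ (toEuclideanCLM (𝕜 := ℝ) (CFC.sqrt Q) a) := by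
    ext z
    simp only [L, ContinuousLinearMap.comp_apply, innerSL_apply_apply]
    rw [← ContinuousLinearMap.adjoint_inner_left, IsSelfAdjoint.adjoint_eq hsa]
  have hv := variance_dual_stdGaussian L
  have hm := integral_strongDual_stdGaussian L
  have hL2 : MemLp L 2 (stdGaussian (EuclideanSpace ℝ (Fin n))) :=
    L.comp_memLp' (IsGaussian.memLp_two_id (μ := stdGaussian (EuclideanSpace ℝ (Fin n))))
  have he := hL2.ofReal_variance_eq
  rw [evariance_eq_lintegral_ofReal, hm, hv] at he
  simp only [sub_zero] at he
  refine he.symm.trans ?_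
  congr 1
  rw [hL, innerSL_apply_norm, ← real_inner_self_eq_norm_sq,
    ← ContinuousLinearMap.adjoint_inner_right, IsSelfAdjoint.adjoint_eq hsa,
    ← mul_apply_eq_comp, ← map_mul, CFC.sqrt_mul_sqrt_self _ hQ.nonneg,
    inner_toEuclideanCLM]

theorem lintegral_norm_sq_toEuclideanCLM {ρ : Measure (EuclideanSpace ℝ (Fin n))}
    [IsProbabilityMeasure ρ] (h : MemLp id 2 ρ) (A : Matrix (Fin n) (Fin n) ℝ) :
    ∫⁻ x, ENNReal.ofReal (‖toEuclideanCLM (𝕜 := ℝ) A (x - ∫ y, y ∂ρ)‖ ^ 2) ∂ρ =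
      ENNReal.ofReal (A * Cov ρ * Aᵀ).trace := by
  have hi : Integrable (fun x : EuclideanSpace ℝ (Fin n) => x) ρ := h.integrable (by norm_num)
  have e : ∀ x, ENNReal.ofReal (‖toEuclideanCLM (𝕜 := ℝ) A (x - ∫ y, y ∂ρ)‖ ^ 2) =
      ∑ i, ENNReal.ofReal ((inner ℝ (WithLp.toLp 2 (A i)) x -
        ∫ y, inner ℝ (WithLp.toLp 2 (A i)) y ∂ρ) ^ 2) := fun x => by
    rw [EuclideanSpace.real_norm_sq_eq, ENNReal.ofReal_sum_of_nonneg fun i _ => sq_nonneg _]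
    refine Finset.sum_congr rfl fun i _ => ?_
    rw [integral_inner hi, ← inner_sub_right, inner_eq_sum]
    congr 2
  simp only [e]
  rw [lintegral_finsetSum _ fun i _ => by fun_prop]
  have e2 : ∀ i, ∫⁻ x, ENNReal.ofReal ((inner ℝ (WithLp.toLp 2 (A i)) x -
        ∫ y, inner ℝ (WithLp.toLp 2 (A i)) y ∂ρ) ^ 2) ∂ρ =
      ENNReal.ofReal (A i ⬝ᵥ Cov ρ *ᵥ A i) := fun i => by
    rw [← evariance_eq_lintegral_ofReal, evariance_inner_eq_dotProduct h]
  simp only [e2]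
  rw [← ENNReal.ofReal_sum_of_nonneg fun i _ => by
    simpa using (posSemidef_Cov h).dotProduct_mulVec_nonneg (A i)]
  congr 1
  simp only [trace, diag_apply, mul_assoc]
  refine Finset.sum_congr rfl fun i _ => ?_
  simp only [dotProduct, mulVec, mul_apply, transpose_apply]

/-- An invertible matrix as a continuous linear equivalence of Euclidean space. -/
def matrixEquiv (A : Matrix (Fin n) (Fin n) ℝ) (hA : IsUnit A.det) :
    EuclideanSpace ℝ (Fin n) ≃L[ℝ] EuclideanSpace ℝ (Fin n) :=
  ContinuousLinearEquiv.equivOfInverse (toEuclideanCLM (𝕜 := ℝ) A) (toEuclideanCLM (𝕜 := ℝ) A⁻¹)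
    (fun x => by
      rw [← mul_apply_eq_comp, ← map_mul, nonsing_inv_mul _ hA, map_one]; rfl)
    (fun x => by
      rw [← mul_apply_eq_comp, ← map_mul, mul_nonsing_inv _ hA, map_one]; rfl)

theorem det_matrixEquiv (A : Matrix (Fin n) (Fin n) ℝ) (hA : IsUnit A.det) :
    LinearMap.det (matrixEquiv A hA : EuclideanSpace ℝ (Fin n) →ₗ[ℝ] EuclideanSpace ℝ (Fin n)) =
      A.det := by
  have : ((matrixEquiv A hA : EuclideanSpace ℝ (Fin n) ≃L[ℝ] EuclideanSpace ℝ (Fin n)) :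
      EuclideanSpace ℝ (Fin n) →ₗ[ℝ] EuclideanSpace ℝ (Fin n)) = A.toEuclideanLin := by
    ext x i; rfl
  rw [this]
  exact LinearMap.det_toLpLin 2 A

theorem isUnit_det_sqrt {A : Matrix (Fin n) (Fin n) ℝ} (hA : A.PosDef) :
    IsUnit (CFC.sqrt A).det := by
  have h := congrArg det (CFC.sqrt_mul_sqrt_self A hA.posSemidef.nonneg)
  rw [det_mul] at h
  refine isUnit_iff_ne_zero.2 fun h0 => hA.det_pos.ne' ?_
  rw [← h, h0, zero_mul]

end

/-! ### Matrix forms of the two channel bounds -/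

section

open Matrix

variable {n : ℕ}

/-- The map `x ↦ Q^{1/2} x` for positive definite `Q`, as a continuous linear equivalence. -/
def sqrtEquiv {Q : Matrix (Fin n) (Fin n) ℝ} (hQ : Q.PosDef) :
    EuclideanSpace ℝ (Fin n) ≃L[ℝ] EuclideanSpace ℝ (Fin n) :=
  matrixEquiv (CFC.sqrt Q) (isUnit_det_sqrt hQ)

/-- The mutual information bound in matrix form. The Gaussian used for comparison has covariance
`Q + 2 Cov μ = Q^{1/2} W Q^{1/2}`, where `W = I + 2 Q^{-1/2} (Cov μ) Q^{-1/2}`. -/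
theorem extExpectation_infoDensity_le_log_det {Q : Matrix (Fin n) (Fin n) ℝ} (hQ : Q.PosDef)
    (μ : Measure (EuclideanSpace ℝ (Fin n))) [IsProbabilityMeasure μ] (hμ : MemLp id 2 μ)
    (U : Measure ℝ) [IsProbabilityMeasure U] (hU : ∀ᵐ t ∂U, t ≤ 2) :
    extExpectation (fun q => (infoDensity (sqrtEquiv hQ) μ q : EReal))
      (obsLaw (sqrtEquiv hQ) μ U ⊗ₘ posteriorKernel (sqrtEquiv hQ) μ) ≤
      ((1 / 2 * Real.log (1 + (2 : ℝ) • (Q⁻¹ * Cov μ)).det : ℝ) : EReal) := by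
  set R := CFC.sqrt Q with hR
  have hRu : IsUnit R.det := isUnit_det_sqrt hQ
  have hRR : R * R = Q := CFC.sqrt_mul_sqrt_self Q hQ.posSemidef.nonneg
  have hRt : Rᵀ = R := by
    have := (CFC.sqrt_nonneg Q).posSemidef.1
    rwa [IsHermitian, conjTranspose_eq_transpose_of_trivial] at this
  have hRit : (R⁻¹)ᵀ = R⁻¹ := by rw [transpose_nonsing_inv, hRt]
  set C := Cov μ with hC
  have hCp : C.PosSemidef := posSemidef_Cov hμ
  set W := 1 + (2 : ℝ) • (R⁻¹ * C * R⁻¹) with hW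
  have hWp : W.PosDef := by
    refine PosDef.one.add_posSemidef (PosSemidef.smul ?_ (by norm_num))
    have := hCp.mul_mul_conjTranspose_same R⁻¹
    rwa [conjTranspose_eq_transpose_of_trivial, hRit] at this
  have hTu : IsUnit (CFC.sqrt W).det := isUnit_det_sqrt hWp
  set T := CFC.sqrt W with hT
  have hTT : T * T = W := CFC.sqrt_mul_sqrt_self W hWp.posSemidef.nonneg
  have hTt : Tᵀ = T := by
    have := (CFC.sqrt_nonneg W).posSemidef.1
    rwa [IsHermitian, conjTranspose_eq_transpose_of_trivial] at this
  have hTit : (T⁻¹)ᵀ = T⁻¹ := by rw [transpose_nonsing_inv, hTt]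
  have htr : 2 * (T⁻¹ * R⁻¹ * C * (T⁻¹ * R⁻¹)ᵀ).trace + (T⁻¹ * 1 * (T⁻¹)ᵀ).trace =
      ((1 : Matrix (Fin n) (Fin n) ℝ) * 1 * 1ᵀ).trace := by
    have h1 : T⁻¹ * W * T⁻¹ = 1 := by
      rw [← hTT, ← mul_assoc, nonsing_inv_mul _ hTu, one_mul, mul_nonsing_inv _ hTu]
    have h2 : (2 : ℝ) • (T⁻¹ * R⁻¹ * C * (T⁻¹ * R⁻¹)ᵀ) + T⁻¹ * 1 * (T⁻¹)ᵀ = T⁻¹ * W * T⁻¹ := by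
      rw [transpose_mul, hTit, hRit, hW, mul_add, add_mul, add_comm]
      simp only [mul_smul_comm, smul_mul_assoc, mul_assoc]
    rw [← smul_eq_mul, ← trace_smul, ← trace_add, h2, h1]
    simp
  have hdet : (1 + (2 : ℝ) • (Q⁻¹ * C)).det = T.det ^ 2 := by
    have := det_one_add_mul_comm R⁻¹ ((2 : ℝ) • (R⁻¹ * C))
    simp only [mul_smul_comm, smul_mul_assoc, ← mul_assoc, ← Matrix.mul_inv_rev, hRR] at this
    rw [sq, ← det_mul, hTT, hW, this]
  rw [hdet, Real.log_pow]
  have hlog : (1 / 2 * ((2 : ℕ) * Real.log T.det) : ℝ) = Real.log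
      |LinearMap.det (matrixEquiv T hTu : EuclideanSpace ℝ (Fin n) →ₗ[ℝ] EuclideanSpace ℝ (Fin n))| := by
    rw [det_matrixEquiv, Real.log_abs]; push_cast; ring
  rw [hlog]
  refine extExpectation_infoDensity_le (sqrtEquiv hQ) μ U (matrixEquiv T hTu) (∫ x, x ∂μ) hU ?_
  have hγ : MemLp id 2 (stdGaussian (EuclideanSpace ℝ (Fin n))) := IsGaussian.memLp_two_id
  have e1 : ∀ x, ‖(matrixEquiv T hTu).symm ((sqrtEquiv hQ).symm (x - ∫ y, y ∂μ))‖ ^ 2 =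
      ‖toEuclideanCLM (𝕜 := ℝ) (T⁻¹ * R⁻¹) (x - ∫ y, y ∂μ)‖ ^ 2 := fun x => by
    rw [map_mul, mul_apply_eq_comp]; rfl
  have e2 : ∀ z, ‖(matrixEquiv T hTu).symm z‖ ^ 2 = ‖toEuclideanCLM (𝕜 := ℝ) (T⁻¹)
      (z - ∫ y, y ∂(stdGaussian (EuclideanSpace ℝ (Fin n))))‖ ^ 2 := fun z => by
    rw [integral_id_stdGaussian, sub_zero]; rfl
  have e3 : ∀ z : EuclideanSpace ℝ (Fin n), ‖z‖ ^ 2 = ‖toEuclideanCLM (𝕜 := ℝ)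
      (1 : Matrix (Fin n) (Fin n) ℝ)
      (z - ∫ y, y ∂(stdGaussian (EuclideanSpace ℝ (Fin n))))‖ ^ 2 := fun z => by
    rw [integral_id_stdGaussian, sub_zero, map_one]; rfl
  simp only [e1, e2]
  rw [lintegral_congr fun z => congrArg ENNReal.ofReal (e3 z), lintegral_norm_sq_toEuclideanCLM hμ, lintegral_norm_sq_toEuclideanCLM hγ,
    lintegral_norm_sq_toEuclideanCLM hγ, Cov_stdGaussian, ← htr, ENNReal.ofReal_add,
    ENNReal.ofReal_mul zero_le_two]
  · simp [hC]
  · refine mul_nonneg zero_le_two ?_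
    have := (hCp.mul_mul_conjTranspose_same (T⁻¹ * R⁻¹)).trace_nonneg
    rwa [conjTranspose_eq_transpose_of_trivial] at this
  · have := (PosSemidef.one.mul_mul_conjTranspose_same T⁻¹).trace_nonneg
    rwa [conjTranspose_eq_transpose_of_trivial] at this

section Dissipation

variable {Q : Matrix (Fin n) (Fin n) ℝ} (hQ : Q.PosDef) (μ : Measure (EuclideanSpace ℝ (Fin n)))
  [IsProbabilityMeasure μ]

/-- The third bound in the direction `u`. The dissipation inequality is applied with the coefficient
`a = Q⁻¹ C u`, cut off where the second order term `⟪a, C a⟫` exceeds `k`; then `k → ∞` by monotone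
convergence. -/
theorem lintegral_cov_inv_cov_le (hμ : MemLp id 2 μ) (U : Measure ℝ) [IsProbabilityMeasure U]
    (hU : U = volume.restrict (Set.Icc 1 2)) (u : Fin n → ℝ) :
    ∫⁻ θ, ENNReal.ofReal (u ⬝ᵥ (Cov (posteriorKernel (sqrtEquiv hQ) μ θ) * Q⁻¹ *
      Cov (posteriorKernel (sqrtEquiv hQ) μ θ)) *ᵥ u) ∂(obsLaw (sqrtEquiv hQ) μ U) ≤
      ENNReal.ofReal (u ⬝ᵥ Cov μ *ᵥ u) := by
  set B := sqrtEquiv hQ with hB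
  set κ := posteriorKernel B μ with hκ
  have hκm : ∀ θ, MemLp id 2 (κ θ) := memLp_posteriorKernel B μ hμ
  have hCp : ∀ θ, (Cov (κ θ)).PosSemidef := fun θ => posSemidef_Cov (hκm θ)
  have hCm : ∀ i j, Measurable fun θ => Cov (κ θ) i j := measurable_Cov_kernel κ
  set u' : EuclideanSpace ℝ (Fin n) := WithLp.toLp 2 u with hu'
  set a : EuclideanSpace ℝ (Fin n) × ℝ → Fin n → ℝ := fun θ => Q⁻¹ *ᵥ (Cov (κ θ) *ᵥ u) with ha
  have ham : ∀ i, Measurable fun θ => a θ i := fun i => by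
    simp only [ha, mulVec, dotProduct]; fun_prop
  set r : EuclideanSpace ℝ (Fin n) × ℝ → ℝ := fun θ => a θ ⬝ᵥ Cov (κ θ) *ᵥ a θ with hr
  have hrm : Measurable r := by
    simp only [hr, mulVec, dotProduct]; fun_prop
  set ψ : EuclideanSpace ℝ (Fin n) × ℝ → ℝ := fun θ => u ⬝ᵥ (Cov (κ θ) * Q⁻¹ * Cov (κ θ)) *ᵥ u with hψ
  have hψa : ∀ θ, a θ ⬝ᵥ Cov (κ θ) *ᵥ u = ψ θ := fun θ => by
    have hCt : (Cov (κ θ))ᵀ = Cov (κ θ) := by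
      simpa [IsHermitian, conjTranspose_eq_transpose_of_trivial] using (hCp θ).1
    have hQt : (Q⁻¹)ᵀ = Q⁻¹ := by
      simpa [IsHermitian, conjTranspose_eq_transpose_of_trivial] using hQ.1.inv
    have : a θ = (Q⁻¹ * Cov (κ θ)) *ᵥ u := mulVec_mulVec _ _ _
    rw [this, ← vecMul_transpose, ← dotProduct_mulVec, transpose_mul, hCt, hQt, mulVec_mulVec]
  have hψs : ∀ θ, u ⬝ᵥ Cov (κ θ) *ᵥ a θ = ψ θ := fun θ => by
    simp only [hψ, ha, mulVec_mulVec, mul_assoc]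
  have hψQ : ∀ θ, a θ ⬝ᵥ Q *ᵥ a θ = ψ θ := fun θ => by
    rw [← hψa θ]
    simp only [ha]
    rw [mulVec_mulVec (M := Q), mul_nonsing_inv _ hQ.det_pos.ne'.isUnit, one_mulVec]
  have hψm : Measurable ψ := by
    have : ψ = fun θ => a θ ⬝ᵥ Cov (κ θ) *ᵥ u := funext fun θ => (hψa θ).symm
    rw [this]; simp only [mulVec, dotProduct]; fun_prop
  have hψ0 : ∀ θ, 0 ≤ ψ θ := fun θ => by
    rw [← hψQ]; simpa using hQ.posSemidef.dotProduct_mulVec_nonneg (a θ)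
  have hr0 : ∀ θ, 0 ≤ r θ := fun θ => by
    simpa using (hCp θ).dotProduct_mulVec_nonneg (a θ)
  set S : ℕ → Set (EuclideanSpace ℝ (Fin n) × ℝ) := fun k => {θ | r θ ≤ k} with hS
  have hSm : ∀ k, MeasurableSet (S k) := fun k => measurableSet_le hrm measurable_const
  set f : ℕ → EuclideanSpace ℝ (Fin n) × ℝ → ℝ≥0∞ := fun k =>
    (S k).indicator fun θ => ENNReal.ofReal (ψ θ) with hf
  have hfm : ∀ k, Measurable (f k) := fun k => hψm.ennreal_ofReal.indicator (hSm k)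
  have hlim : ∫⁻ θ, ENNReal.ofReal (ψ θ) ∂(obsLaw B μ U) = ⨆ k, ∫⁻ θ, f k θ ∂(obsLaw B μ U) := by
    rw [← lintegral_iSup hfm]
    · refine lintegral_congr fun θ => le_antisymm ?_ (iSup_le fun k => Set.indicator_le_self _ _ θ)
      obtain ⟨k, hk⟩ := exists_nat_ge (r θ)
      refine le_iSup_of_le k ?_
      have : θ ∈ S k := hk
      simp [hf, this]
    · intro k l hkl θ
      refine Set.indicator_le_indicator_of_subset (fun θ hθ => ?_) (fun _ => zero_le) θ
      exact le_trans (show r θ ≤ k from hθ) (by exact_mod_cast hkl)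
  have hV : eVar[fun x => inner ℝ u' x; μ] = ENNReal.ofReal (u ⬝ᵥ Cov μ *ᵥ u) :=
    evariance_inner_eq_dotProduct hμ u'
  change ∫⁻ θ, ENNReal.ofReal (ψ θ) ∂(obsLaw B μ U) ≤ _
  rw [hlim]
  refine iSup_le fun k => ?_
  rw [lintegral_obsLaw_eq_lintegral_dirac B μ U (hfm k), hU]
  refine lintegral_le_of_dissipation (D := mmse B μ u') (K := k) ?_
    (measurable_lintegral_obsLaw_dirac B μ (hfm k)) ENNReal.ofReal_ne_top (by simp)
    (fun s => (mmse_le_evariance B μ u' s).trans_eq hV) ?_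
  · exact measurable_lintegral_obsLaw_dirac B μ
      (measurable_evariance_posteriorKernel B μ hμ measurable_const)
  intro s δ hs hδ
  set b : EuclideanSpace ℝ (Fin n) × ℝ → EuclideanSpace ℝ (Fin n) :=
    (S k).indicator fun θ => WithLp.toLp 2 (a θ) with hb
  have hbm : Measurable b := by
    refine Measurable.indicator ?_ (hSm k)
    exact (WithLp.measurable_toLp 2 _).comp (measurable_pi_lambda _ ham)
  have h1 := mmse_add_le B μ hμ u' hs hδ hbm
  have hptw : ∀ θ, eVar[fun x => inner ℝ (u' - δ • b θ) x; κ θ] + ENNReal.ofReal δ *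
      ∫⁻ z, ENNReal.ofReal (inner ℝ (b θ) (B z) ^ 2) ∂(stdGaussian (EuclideanSpace ℝ (Fin n))) +
      ENNReal.ofReal δ * f k θ ≤ eVar[fun x => inner ℝ u' x; κ θ] + ENNReal.ofReal (δ ^ 2) * k := by
    intro θ
    -- On `S k`, the left side is `⟪u, C u⟫ - 2 δ ψ + δ² r + δ ψ + δ ψ`, and `r ≤ k`.
    have hN := lintegral_inner_sqrt_sq hQ.posSemidef (b θ)
    change ∫⁻ z, ENNReal.ofReal (inner ℝ (b θ) (B z) ^ 2)
      ∂(stdGaussian (EuclideanSpace ℝ (Fin n))) = _ at hN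
    rw [hN, evariance_inner_eq_dotProduct (hκm θ), evariance_inner_eq_dotProduct (hκm θ)]
    by_cases hθ : θ ∈ S k
    · have hbθ : b θ = WithLp.toLp 2 (a θ) := by simp [hb, hθ]
      have hfθ : f k θ = ENNReal.ofReal (ψ θ) := by simp [hf, hθ]
      have hexp : (u' - δ • b θ).ofLp ⬝ᵥ Cov (κ θ) *ᵥ (u' - δ • b θ).ofLp =
          u ⬝ᵥ Cov (κ θ) *ᵥ u - 2 * δ * ψ θ + δ ^ 2 * r θ := by
        have : (u' - δ • b θ).ofLp = u - δ • a θ := by rw [hbθ]; rfl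
        rw [this]
        simp only [mulVec_sub, mulVec_smul, sub_dotProduct, dotProduct_sub, smul_dotProduct,
          dotProduct_smul, hψa, hψs, smul_eq_mul, hr]
        ring
      have hexp0 : 0 ≤ (u' - δ • b θ).ofLp ⬝ᵥ Cov (κ θ) *ᵥ (u' - δ • b θ).ofLp := by
        simpa using (hCp θ).dotProduct_mulVec_nonneg (u' - δ • b θ).ofLp
      have hu0 : 0 ≤ u ⬝ᵥ Cov (κ θ) *ᵥ u := by simpa using (hCp θ).dotProduct_mulVec_nonneg u
      have hk : (k : ℝ≥0∞) = ENNReal.ofReal k := by simp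
      rw [hfθ, hbθ, hψQ θ, ← hbθ, ← ENNReal.ofReal_mul hδ.le,
        ← ENNReal.ofReal_add hexp0 (mul_nonneg hδ.le (hψ0 θ)),
        ← ENNReal.ofReal_add (add_nonneg hexp0 (mul_nonneg hδ.le (hψ0 θ))) (mul_nonneg hδ.le (hψ0 θ)),
        hk, ← ENNReal.ofReal_mul (sq_nonneg δ), ← ENNReal.ofReal_add hu0 (by positivity), hexp]
      refine ENNReal.ofReal_le_ofReal ?_
      have hrk : r θ ≤ k := hθ
      have := mul_le_mul_of_nonneg_left hrk (sq_nonneg δ)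
      linarith
    · have hbθ : b θ = 0 := by simp [hb, hθ]
      have hfθ : f k θ = 0 := by simp [hf, hθ]
      simp [hbθ, hfθ]
  calc mmse B μ u' (s + δ) + ENNReal.ofReal δ * ∫⁻ θ, f k θ ∂(obsLaw B μ (Measure.dirac s)) ≤
      ∫⁻ θ, (eVar[fun x => inner ℝ (u' - δ • b θ) x; κ θ] + ENNReal.ofReal δ *
      ∫⁻ z, ENNReal.ofReal (inner ℝ (b θ) (B z) ^ 2) ∂(stdGaussian (EuclideanSpace ℝ (Fin n))) +
      ENNReal.ofReal δ * f k θ) ∂(obsLaw B μ (Measure.dirac s)) := by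
        rw [lintegral_add_right _ ((hfm k).const_mul _), lintegral_const_mul _ (hfm k)]
        gcongr
    _ ≤ ∫⁻ θ, (eVar[fun x => inner ℝ u' x; κ θ] + ENNReal.ofReal (δ ^ 2) * k)
        ∂(obsLaw B μ (Measure.dirac s)) := lintegral_mono hptw
    _ = _ := by
        rw [lintegral_add_right _ measurable_const]
        simp [mmse, hκ]

end Dissipation

end

/-! ### The conditional law of the signal -/

section

open Matrix

theorem lintegral_lintegral_condDistrib {α β Ω : Type*} [MeasurableSpace α] [MeasurableSpace β]
    [StandardBorelSpace β] [Nonempty β] [MeasurableSpace Ω] {P : Measure Ω} [IsFiniteMeasure P]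
    {X : Ω → β} {Y : Ω → α} (hX : AEMeasurable X P) (hY : AEMeasurable Y P) {f : α × β → ℝ≥0∞}
    (hf : Measurable f) :
    ∫⁻ ω, ∫⁻ b, f (Y ω, b) ∂(condDistrib X Y P (Y ω)) ∂P = ∫⁻ ω, f (Y ω, X ω) ∂P := by
  have hm : Measurable fun a => ∫⁻ b, f (a, b) ∂(condDistrib X Y P a) :=
    hf.lintegral_kernel_prod_right'
  rw [← lintegral_map' hm.aemeasurable hY, ← Measure.lintegral_compProd hf,
    compProd_map_condDistrib hX, lintegral_map' hf.aemeasurable (hY.prodMk hX)]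

section Observation

variable {n : ℕ} {Ω : Type*} [MeasurableSpace Ω] {P : Measure Ω} [IsProbabilityMeasure P]
  {μ : Measure (EuclideanSpace ℝ (Fin n))} {Q : Matrix (Fin n) (Fin n) ℝ}
  {x z : Ω → EuclideanSpace ℝ (Fin n)} {τ : Ω → ℝ}

theorem map_eq_restrict_of_isUniform (hτ : pdf.IsUniform τ (Set.Icc 1 2) P volume) :
    P.map τ = volume.restrict (Set.Icc 1 2) := by
  have hvol : (volume (Set.Icc (1 : ℝ) 2)) = 1 := by simp; norm_num
  rw [hτ, ProbabilityTheory.cond, hvol]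
  simp

theorem aemeasurable_of_isUniform (hτ : pdf.IsUniform τ (Set.Icc 1 2) P volume) :
    AEMeasurable τ P :=
  hτ.aemeasurable (by simp) (by simp)

theorem ae_mem_of_isUniform (hτ : pdf.IsUniform τ (Set.Icc 1 2) P volume) :
    ∀ᵐ ω ∂P, τ ω ∈ Set.Icc 1 2 := by
  have h : ∀ᵐ t ∂(P.map τ), t ∈ Set.Icc (1 : ℝ) 2 := by
    rw [map_eq_restrict_of_isUniform hτ]
    exact ae_restrict_mem measurableSet_Icc
  exact ae_of_ae_map (aemeasurable_of_isUniform hτ) h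

theorem aemeasurable_observation (hx : AEMeasurable x P) (hz : AEMeasurable z P)
    (hτ : AEMeasurable τ P) : AEMeasurable (observation Q x z τ) P := by
  have h1 : AEMeasurable (fun ω => toEuclideanCLM (𝕜 := ℝ) (CFC.sqrt Q) (z ω)) P :=
    (toEuclideanCLM (𝕜 := ℝ) (CFC.sqrt Q)).continuous.measurable.comp_aemeasurable hz
  have h2 : AEMeasurable (fun ω => √(τ ω)) P := Real.continuous_sqrt.measurable.comp_aemeasurable hτ
  exact ((h2.smul hx).add h1).prodMk hτ

theorem measurable_Cov_posterior (hx : AEMeasurable x P) (hz : AEMeasurable z P)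
    (hτ : AEMeasurable τ P) (i j : Fin n) :
    AEMeasurable (fun ω => Cov (posterior P Q x z τ ω) i j) P :=
  (measurable_Cov_kernel (condDistrib x (observation Q x z τ) P) i j).comp_aemeasurable
    (aemeasurable_observation hx hz hτ)

instance (ω : Ω) : IsProbabilityMeasure (posterior P Q x z τ ω) := by
  unfold posterior; infer_instance

/-- The estimator `y / √τ` of the signal has error `-Q^{1/2} z / √τ`, and `τ ≥ 1`. -/
theorem lintegral_posterior_sq_error_le {F : Type*} [NormedAddCommGroup F] [InnerProductSpace ℝ F]
    (hx : AEMeasurable x P) (hz : HasLaw z (stdGaussian (EuclideanSpace ℝ (Fin n))) P)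
    (hτ : pdf.IsUniform τ (Set.Icc 1 2) P volume) (L : EuclideanSpace ℝ (Fin n) →L[ℝ] F) :
    ∫⁻ ω, ∫⁻ v, ENNReal.ofReal (‖L (v - (√(τ ω))⁻¹ • (observation Q x z τ ω).1)‖ ^ 2)
      ∂(posterior P Q x z τ ω) ∂P ≤
      ∫⁻ w, ENNReal.ofReal (‖L (toEuclideanCLM (𝕜 := ℝ) (CFC.sqrt Q) w)‖ ^ 2)
        ∂(stdGaussian (EuclideanSpace ℝ (Fin n))) := by
  have hτm := aemeasurable_of_isUniform hτ
  have hL : Measurable fun v => ENNReal.ofReal (‖L v‖ ^ 2) :=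
    (Continuous.measurable (f := fun v => ‖L v‖ ^ 2) (by fun_prop)).ennreal_ofReal
  have hd : Measurable fun p : (EuclideanSpace ℝ (Fin n) × ℝ) × EuclideanSpace ℝ (Fin n) =>
      p.2 - (√p.1.2)⁻¹ • p.1.1 := by fun_prop
  have hLR : Measurable fun w => ENNReal.ofReal (‖L (toEuclideanCLM (𝕜 := ℝ) (CFC.sqrt Q) w)‖ ^ 2) :=
    hL.comp (toEuclideanCLM (𝕜 := ℝ) (CFC.sqrt Q)).continuous.measurable
  have h := lintegral_lintegral_condDistrib (P := P) hx
    (aemeasurable_observation (Q := Q) hx hz.aemeasurable hτm) (hL.comp hd)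
  refine h.trans_le ?_
  rw [← hz.map_eq, lintegral_map' hLR.aemeasurable hz.aemeasurable]
  refine lintegral_mono_ae ?_
  filter_upwards [ae_mem_of_isUniform hτ] with ω hω
  refine ENNReal.ofReal_le_ofReal ?_
  have hs : 1 ≤ √(τ ω) := by rw [Real.one_le_sqrt]; exact hω.1
  have hs0 : √(τ ω) ≠ 0 := by positivity
  have e : L (x ω - (√(τ ω))⁻¹ • (√(τ ω) • x ω + toEuclideanCLM (𝕜 := ℝ) (CFC.sqrt Q) (z ω))) =
      -((√(τ ω))⁻¹ • L (toEuclideanCLM (𝕜 := ℝ) (CFC.sqrt Q) (z ω))) := by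
    rw [smul_add, smul_smul, inv_mul_cancel₀ hs0, one_smul, sub_add_cancel_left, map_neg, map_smul]
  simp only [observation]
  rw [e, norm_neg, norm_smul, mul_pow]
  refine mul_le_of_le_one_left (sq_nonneg _) (pow_le_one₀ (norm_nonneg _) ?_)
  rw [norm_inv, Real.norm_of_nonneg (Real.sqrt_nonneg _)]
  exact inv_le_one_of_one_le₀ hs

theorem memLp_posterior
    (hx : AEMeasurable x P) (hz : HasLaw z (stdGaussian (EuclideanSpace ℝ (Fin n))) P)
    (hτ : pdf.IsUniform τ (Set.Icc 1 2) P volume) :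
    ∀ᵐ ω ∂P, MemLp id 2 (posterior P Q x z τ ω) := by
  have hτm := aemeasurable_of_isUniform hτ
  have h := lintegral_posterior_sq_error_le (Q := Q) hx hz hτ (ContinuousLinearMap.id ℝ _)
  have hfin : ∫⁻ ω, ∫⁻ v, ENNReal.ofReal (‖v - (√(τ ω))⁻¹ • (observation Q x z τ ω).1‖ ^ 2)
      ∂(posterior P Q x z τ ω) ∂P ≠ ⊤ :=
    ne_top_of_le_ne_top (lintegral_norm_sq_stdGaussian_ne_top
      (toEuclideanCLM (𝕜 := ℝ) (CFC.sqrt Q))) h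
  have hm : AEMeasurable (fun ω => ∫⁻ v, ENNReal.ofReal
      (‖v - (√(τ ω))⁻¹ • (observation Q x z τ ω).1‖ ^ 2) ∂(posterior P Q x z τ ω)) P := by
    have := Measurable.lintegral_kernel_prod_right' (κ := condDistrib x (observation Q x z τ) P)
      (f := fun p => ENNReal.ofReal (‖p.2 - (√p.1.2)⁻¹ • p.1.1‖ ^ 2)) (by fun_prop)
    exact this.comp_aemeasurable (aemeasurable_observation hx hz.aemeasurable hτm)
  filter_upwards [ae_lt_top' hm hfin] with ω hω
  set c := (√(τ ω))⁻¹ • (observation Q x z τ ω).1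
  have h1 : MemLp (fun v => v - c) 2 (posterior P Q x z τ ω) := by
    rw [memLp_two_iff_integrable_sq_norm (by fun_prop)]
    refine ⟨by fun_prop, ?_⟩
    rw [hasFiniteIntegral_iff_ofReal (ae_of_all _ fun v => by positivity)]
    exact hω
  have := h1.add (memLp_const c)
  simpa [Pi.add_def, Function.id_def] using this

theorem lintegral_quadForm_Cov_posterior_le (hQ : Q.PosSemidef)
    (hx : AEMeasurable x P) (hz : HasLaw z (stdGaussian (EuclideanSpace ℝ (Fin n))) P)
    (hτ : pdf.IsUniform τ (Set.Icc 1 2) P volume) (u : Fin n → ℝ) :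
    ∫⁻ ω, ENNReal.ofReal (u ⬝ᵥ Cov (posterior P Q x z τ ω) *ᵥ u) ∂P ≤
      ENNReal.ofReal (u ⬝ᵥ Q *ᵥ u) := by
  have h := lintegral_posterior_sq_error_le (Q := Q) hx hz hτ (innerSL ℝ (WithLp.toLp 2 u))
  simp only [innerSL_apply_apply, Real.norm_eq_abs, sq_abs, inner_sub_right] at h
  rw [lintegral_inner_sqrt_sq hQ] at h
  refine le_trans (lintegral_mono_ae ?_) h
  filter_upwards [memLp_posterior (Q := Q) hx hz hτ] with ω hω
  rw [← evariance_inner_eq_dotProduct hω (WithLp.toLp 2 u)]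
  exact evariance_le_lintegral_sq_sub _ (Continuous.aestronglyMeasurable (by fun_prop)) _

theorem map_signal_noise_time (hx : HasLaw x μ P)
    (hz : HasLaw z (stdGaussian (EuclideanSpace ℝ (Fin n))) P)
    (hτ : AEMeasurable τ P) (hxz : IndepFun x z P) (hxzτ : IndepFun (fun ω => (x ω, z ω)) τ P) :
    P.map (fun ω => ((x ω, z ω), τ ω)) =
      (μ.prod (stdGaussian (EuclideanSpace ℝ (Fin n)))).prod (P.map τ) := by
  rw [(indepFun_iff_map_prod_eq_prod_map_map (hx.aemeasurable.prodMk hz.aemeasurable) hτ).1 hxzτ,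
    (indepFun_iff_map_prod_eq_prod_map_map hx.aemeasurable hz.aemeasurable).1 hxz, hx.map_eq,
    hz.map_eq]

variable (hQ : Q.PosDef) [IsProbabilityMeasure μ]

theorem map_observation (hx : HasLaw x μ P)
    (hz : HasLaw z (stdGaussian (EuclideanSpace ℝ (Fin n))) P)
    (hτ : AEMeasurable τ P) (hxz : IndepFun x z P) (hxzτ : IndepFun (fun ω => (x ω, z ω)) τ P) :
    P.map (observation Q x z τ) = obsLaw (sqrtEquiv hQ) μ (P.map τ) := by
  rw [obsLaw, ← map_signal_noise_time hx hz hτ hxz hxzτ, AEMeasurable.map_map_of_aemeasurable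
    (measurable_channelMap _).aemeasurable ((hx.aemeasurable.prodMk hz.aemeasurable).prodMk hτ)]
  rfl

/-- Almost surely the regular conditional law of the signal is the one given by Bayes' formula. -/
theorem posterior_ae_eq_posteriorKernel (hx : HasLaw x μ P)
    (hz : HasLaw z (stdGaussian (EuclideanSpace ℝ (Fin n))) P)
    (hτ : AEMeasurable τ P) (hxz : IndepFun x z P) (hxzτ : IndepFun (fun ω => (x ω, z ω)) τ P) :
    ∀ᵐ ω ∂P, posterior P Q x z τ ω =
      posteriorKernel (sqrtEquiv hQ) μ (observation Q x z τ ω) := by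
  have := Measure.isProbabilityMeasure_map hτ
  refine ae_of_ae_map (aemeasurable_observation hx.aemeasurable hz.aemeasurable hτ)
    (condDistrib_ae_eq_of_measure_eq_compProd _ hx.aemeasurable ?_)
  have hm : Measurable fun p : (EuclideanSpace ℝ (Fin n) × EuclideanSpace ℝ (Fin n)) × ℝ =>
      (channelMap (sqrtEquiv hQ) p, p.1.1) := (measurable_channelMap _).prodMk (by fun_prop)
  rw [map_observation hQ hx hz hτ hxz hxzτ, ← map_channel_eq_compProd,
    ← map_signal_noise_time hx hz hτ hxz hxzτ, AEMeasurable.map_map_of_aemeasurable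
    hm.aemeasurable ((hx.aemeasurable.prodMk hz.aemeasurable).prodMk hτ)]
  rfl

end Observation

end

end GaussChannel

end

theorem theorem1 {n : ℕ} {Ω : Type*} [MeasurableSpace Ω] (P : Measure Ω) [IsProbabilityMeasure P]
    (μ ν : Measure (EuclideanSpace ℝ (Fin n))) [IsProbabilityMeasure μ] [SigmaFinite ν]
    (hμν : μ ≪ ν)
    (Q : Matrix (Fin n) (Fin n) ℝ) (hQ : Q.PosSemidef)
    (x z : Ω → EuclideanSpace ℝ (Fin n)) (τ : Ω → ℝ)
    (hx : HasLaw x μ P)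
    (hz : HasLaw z (stdGaussian (EuclideanSpace ℝ (Fin n))) P)
    (hτ : pdf.IsUniform τ (Set.Icc 1 2) P volume)
    -- mutual independence of the triple
    (hxz : IndepFun x z P) (hxzτ : IndepFun (fun ω => (x ω, z ω)) τ P) :
    -- the first bound
    ((∀ᵐ ω ∂P, MemLp id 2 (GaussChannel.posterior P Q x z τ ω)) ∧
      (∀ i j, Integrable (fun ω => GaussChannel.Cov (GaussChannel.posterior P Q x z τ ω) i j) P) ∧
      GaussChannel.expMatrix P
        (fun ω => GaussChannel.Cov (GaussChannel.posterior P Q x z τ ω)) ≤ Q) ∧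
    -- the second bound
    (Q.PosDef →
      (∀ᵐ ω ∂P, GaussChannel.posterior P Q x z τ ω ≪ μ) ∧
      (GaussChannel.relEntropy μ ν ≠ ⊥ →
        AEMeasurable
          (fun ω => GaussChannel.relEntropy (GaussChannel.posterior P Q x z τ ω) ν) P ∧
        GaussChannel.relEntropy μ ν ≤ GaussChannel.extExpectation
          (fun ω => GaussChannel.relEntropy (GaussChannel.posterior P Q x z τ ω) ν) P ∧
        (MemLp id 2 μ →
          GaussChannel.extExpectation
            (fun ω => GaussChannel.relEntropy (GaussChannel.posterior P Q x z τ ω) ν) P ≤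
          GaussChannel.relEntropy μ ν +
            ((1 / 2 * Real.log (1 + (2 : ℝ) • (Q⁻¹ * GaussChannel.Cov μ)).det : ℝ) : EReal)))) ∧
    -- the third bound
    (Q.PosDef → MemLp id 2 μ →
      (∀ i j, Integrable (fun ω => (GaussChannel.Cov (GaussChannel.posterior P Q x z τ ω) * Q⁻¹ *
        GaussChannel.Cov (GaussChannel.posterior P Q x z τ ω)) i j) P) ∧
      GaussChannel.expMatrix P
        (fun ω => GaussChannel.Cov (GaussChannel.posterior P Q x z τ ω) * Q⁻¹ *
          GaussChannel.Cov (GaussChannel.posterior P Q x z τ ω)) ≤ GaussChannel.Cov μ) := by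

  have hxm := hx.aemeasurable
  have hzm := hz.aemeasurable
  have hτm := GaussChannel.aemeasurable_of_isUniform hτ
  have hobs := GaussChannel.aemeasurable_observation (Q := Q) hxm hzm hτm
  have hU := Measure.isProbabilityMeasure_map hτm
  have hUv := GaussChannel.map_eq_restrict_of_isUniform hτ
  have hmem := GaussChannel.memLp_posterior (Q := Q) hxm hz hτ
  have hCm := GaussChannel.measurable_Cov_posterior (Q := Q) hxm hzm hτm
  refine ⟨⟨hmem, ?_⟩, fun hQd => ⟨?_, fun hD => ?_⟩, fun hQd hμ => ?_⟩
  · exact GaussChannel.integrable_and_expMatrix_le (fun i j => (hCm i j).aestronglyMeasurable)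
      (hmem.mono fun ω hω => GaussChannel.posSemidef_Cov hω) hQ
      (GaussChannel.lintegral_quadForm_Cov_posterior_le hQ hxm hz hτ)
  · filter_upwards [GaussChannel.posterior_ae_eq_posteriorKernel hQd hx hz hτm hxz hxzτ] with ω hω
    rw [hω]
    exact GaussChannel.posteriorKernel_absolutelyContinuous _ μ _
  · have hpost := GaussChannel.posterior_ae_eq_posteriorKernel hQd hx hz hτm hxz hxzτ
    have hm := GaussChannel.measurable_relEntropy_posteriorKernel
      (GaussChannel.sqrtEquiv hQd) μ ν hμν
    have heq : (fun ω => GaussChannel.relEntropy (GaussChannel.posterior P Q x z τ ω) ν) =ᵐ[P]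
        fun ω => GaussChannel.relEntropy (GaussChannel.posteriorKernel (GaussChannel.sqrtEquiv hQd) μ
          (GaussChannel.observation Q x z τ ω)) ν := hpost.mono fun ω hω => by simp only [hω]
    have hE : GaussChannel.extExpectation
        (fun ω => GaussChannel.relEntropy (GaussChannel.posterior P Q x z τ ω) ν) P = _ :=
      (GaussChannel.extExpectation_congr heq).trans
        ((GaussChannel.extExpectation_map hobs hm.aemeasurable).symm.trans
          (by rw [GaussChannel.map_observation hQd hx hz hτm hxz hxzτ,
            GaussChannel.extExpectation_relEntropy_posteriorKernel _ μ _ ν hμν hD]))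
    refine ⟨(hm.comp_aemeasurable hobs).congr heq.symm, ?_, fun hμ => ?_⟩
    · rw [hE]
      exact le_add_of_nonneg_left (GaussChannel.extExpectation_infoDensity_nonneg _ μ _)
    · rw [hE, add_comm]
      gcongr
      refine GaussChannel.extExpectation_infoDensity_le_log_det hQd μ hμ _ ?_
      rw [hUv]
      filter_upwards [ae_restrict_mem measurableSet_Icc] with t ht using ht.2
  · have hpost := GaussChannel.posterior_ae_eq_posteriorKernel hQd hx hz hτm hxz hxzτ
    have hQi : Q⁻¹.PosSemidef := hQd.inv.posSemidef
    refine GaussChannel.integrable_and_expMatrix_le (fun i j => ?_)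
      (hmem.mono fun ω hω => ?_) (GaussChannel.posSemidef_Cov hμ) fun u => ?_
    · simp only [Matrix.mul_apply]
      exact AEMeasurable.aestronglyMeasurable (by fun_prop)
    · have hC := GaussChannel.posSemidef_Cov hω
      have := hQi.mul_mul_conjTranspose_same (GaussChannel.Cov (GaussChannel.posterior P Q x z τ ω))
      rwa [hC.1] at this
    · have h := GaussChannel.lintegral_cov_inv_cov_le hQd μ hμ (P.map τ) hUv u
      refine le_trans (le_of_eq ?_) h
      rw [← GaussChannel.map_observation hQd hx hz hτm hxz hxzτ, lintegral_map' _ hobs]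
      · exact lintegral_congr_ae (hpost.mono fun ω hω => by simp only [hω])
      · have := GaussChannel.measurable_Cov_kernel
          (GaussChannel.posteriorKernel (GaussChannel.sqrtEquiv hQd) μ)
        refine Measurable.aemeasurable ?_
        simp only [Matrix.mul_apply, dotProduct, Matrix.mulVec]
        fun_prop
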